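/- Let $D\subset\mathbb{R}^N$ be a bounded domain (non-empty connected open set) whose boundary $\partial D$ is $\mathcal{C}^2$-smooth and connected. Then there is a metric $d$ on $D$ such that $(D,d)$ is a geodesic metric space, $(D,d)$ is hyperbolic in the sense of Gromov, and the boundary $\partial_G^d D$ of $(D,d)$ as a hyperbolic space coincides, also topologically, with $\partial D$: every sequence of $D$ converging at infinity in $(D,d)$ converges for the Euclidean metric to a point of $\partial D$, and assigning this limit to the class of the sequence gives a well-defined homeomorphism $\partial_G^d D\to\partial D$. More precisely, such a $d$ is given by the following construction. Choose - a metric $d_H$ on $\partial D$ that induces the standard topology and for which $\partial D$ is geodesic; - for each $x\in D$ a point $\pi(x)\in\partial D$ with $\|x-\pi(x)\|=\mathrm{dist}(x,\partial D)$; - an $\epsilon>0$ such that for all $p\in\partial D$ the closed ball of radius $\epsilon$ centred at $p-\epsilon\vec n_p$ is contained in $D\cup\{p\}$, where $\vec n_p$ is the outer unit normal to $D$ at $p$. Such choices exist. Put $h(x)=\sqrt{\mathrm{dist}(x,\partial D)}$, $D_\epsilon=\{x\in D : h(x)^2\le\epsilon\}$, $x_\epsilon=\pi(x)-\epsilon\vec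 n_{\pi(x)}$, and $$g(x,y)=2\ln\left(\frac{d_H(\pi(x),\pi(y))+\max(h(x),h(y))}{\sqrt{h(x)h(y)}}\right)\qquad(x,y\in D).$$ For $x,y\in D_\epsilon$ let $d(x,y)$ be the infimum of the $g$-lengths $\sup_{0=t_0\le\dots\le t_n=1}\sum_i g(\gamma(t_{i-1}),\gamma(t_i))$ of the paths $\gamma:[0,1]\to D_\epsilon$ from $x$ to $y$. For $x\in D_\epsilon$, $y\notin D_\epsilon$ let $d(x,y)=d(y,x)=d(x,y_\epsilon)+\|y-y_\epsilon\|$. For $x,y\notin D_\epsilon$ let $d(x,y)=\|x-y\|$ if $\pi(x)=\pi(y)$, and $d(x,y)=\|x-x_\epsilon\|+d(x_\epsilon,y_\epsilon)+\|y-y_\epsilon\|$ otherwise. For every such choice of $d_H$, $\pi$, $\epsilon$, the function $d$ is a metric on $D$ with all the properties above. Here $(D,d)$ is hyperbolic in the sense of Gromov if for some $\delta\ge0$ all $x,y,z,t$ satisfy $d(x,y)+d(z,t)\le\max(d(x,z)+d(y,t),\,d(x,t)+d(y,z))+2\delta$. For a basepoint $\omega\in D$ (any), $(x,y)_\omega=\frac12(d(x,\omega)+d(y,\omega)-d(x,y))$;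 a sequence $(x_i)$ converges at infinity if $(x_i,x_j)_\omega\to+\infty$ as $i,j\to\infty$; two such sequences are equivalent if $(x_i,y_i)_\omega\to+\infty$; $\partial_G^dD$ is the set of classes, with the topology for which the sets $\{b : \exp(-(a,b)_\omega)<r\}$, $r>0$, form a base of neighbourhoods of $a$, where $(a,b)_\omega$ is the supremum of $\liminf_i(x_i,y_i)_\omega$ over all sequences $(x_i)$, $(y_i)$ representing $a$, $b$. -/

import Mathlib

open Filter Topology
open scoped ENNReal

noncomputable section

/-! ### Metrics given by a distance function -/

/-- `d` is a metric on `X` (nonnegativity follows from the four axioms). -/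
structure IsMetric {X : Type*} (d : X → X → ℝ) : Prop where
  self_eq_zero : ∀ x, d x x = 0
  eq_of_eq_zero : ∀ x y, d x y = 0 → x = y
  symm : ∀ x y, d x y = d y x
  triangle : ∀ x y z, d x z ≤ d x y + d y z

/-- Any two points are joined by a geodesic segment, i.e. by an isometric embedding of
`[0, d x y]`. -/
def IsGeodesic {X : Type*} (d : X → X → ℝ) : Prop :=
  ∀ x y : X, ∃ γ : ℝ → X, γ 0 = x ∧ γ (d x y) = y ∧
    ∀ s ∈ Set.Icc 0 (d x y), ∀ t ∈ Set.Icc 0 (d x y), d (γ s) (γ t) = |s - t|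

/-- The topology induced by `d` is the given topology of `X`. -/
def InducesTopology {X : Type*} [TopologicalSpace X] (d : X → X → ℝ) : Prop :=
  ∀ s : Set X, IsOpen s ↔ ∀ p ∈ s, ∃ r : ℝ, 0 < r ∧ ∀ q, d p q < r → q ∈ s

/-- Hyperbolicity in the sense of Gromov (four-point condition). -/
def IsGromovHyperbolic {X : Type*} (d : X → X → ℝ) : Prop :=
  ∃ δ : ℝ, 0 ≤ δ ∧ ∀ x y z t : X,
    d x y + d z t ≤ max (d x z + d y t) (d x t + d y z) + 2 * δ

/-- The length of `γ` measured with `ρ`: the supremum of `∑ ρ (γ (t i)) (γ (t (i + 1)))` over all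
finite nondecreasing sequences in `[0, 1]`. As the summands are nonnegative, it is the same to ask
that the sequences start at `0` and end at `1`. -/
def pathLength {X : Type*} (ρ : X → X → ℝ) (γ : unitInterval → X) : ℝ≥0∞ :=
  ⨆ (n : ℕ) (t : ℕ → unitInterval) (_ : Monotone t),
    ∑ i ∈ Finset.range n, ENNReal.ofReal (ρ (γ (t i)) (γ (t (i + 1))))

/-! ### The boundary of a Gromov hyperbolic space -/

/-- The Gromov product of `x` and `y` with basepoint `ω`. -/
def gromovProduct {X : Type*} (d : X → X → ℝ) (ω x y : X) : ℝ :=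
  (d x ω + d y ω - d x y) / 2

/-- Sequences converging at infinity: `(x i, x j)_ω → ∞` as `i, j → ∞`. -/
def SeqAtInfinity {X : Type*} (d : X → X → ℝ) (ω : X) : Type _ :=
  {x : ℕ → X // Tendsto (fun p : ℕ × ℕ => gromovProduct d ω (x p.1) (x p.2)) atTop atTop}

/-- Two sequences converging at infinity are equivalent if `(x i, y i)_ω → ∞`. -/
def SeqEquiv {X : Type*} (d : X → X → ℝ) (ω : X) (x y : SeqAtInfinity d ω) : Prop :=
  Tendsto (fun i : ℕ => gromovProduct d ω (x.1 i) (y.1 i)) atTop atTop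

theorem seqEquiv_equivalence {X : Type*} {d : X → X → ℝ} (hd : IsMetric d)
    (hh : IsGromovHyperbolic d) (ω : X) : Equivalence (SeqEquiv d ω) := by
  refine ⟨fun x => ?_, fun {x y} h => ?_, fun {x y z} h1 h2 => ?_⟩
  · exact x.2.comp (tendsto_atTop_diagonal)
  · refine h.congr fun i => ?_
    simp only [gromovProduct, hd.symm (x.1 i) (y.1 i)]
    ring
  · obtain ⟨δ, -, hδ⟩ := hh
    unfold SeqEquiv at *
    rw [tendsto_atTop] at *
    intro b
    filter_upwards [h1 (b + δ), h2 (b + δ)] with i h1 h2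
    have := hδ (x.1 i) (z.1 i) (y.1 i) ω
    simp only [gromovProduct] at *
    rw [hd.symm (z.1 i) (y.1 i)] at this
    rcases max_cases (d (x.1 i) (y.1 i) + d (z.1 i) ω) (d (x.1 i) ω + d (y.1 i) (z.1 i)) with
      h | h <;> rw [h.1] at this
    · linarith
    · rw [hd.symm (y.1 i) (z.1 i)] at *
      linarith

/-- The boundary of `(X, d)` as a hyperbolic space: classes of sequences converging at infinity.
(`SeqEquiv` is an equivalence relation for every Gromov hyperbolic metric `d`.) -/
def GromovBoundary {X : Type*} (d : X → X → ℝ) (ω : X) : Type _ := Quot (SeqEquiv d ω)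

/-- The class of a sequence converging at infinity. -/
def GromovBoundary.mk {X : Type*} {d : X → X → ℝ} {ω : X} (x : SeqAtInfinity d ω) :
    GromovBoundary d ω := Quot.mk _ x

/-- The Gromov product of two boundary points, with values in `[-∞, ∞]`: the supremum of
`liminf (x i, y i)_ω` over all representatives. -/
def boundaryGromovProduct {X : Type*} (d : X → X → ℝ) (ω : X) (a b : GromovBoundary d ω) : EReal :=
  ⨆ (x : SeqAtInfinity d ω) (y : SeqAtInfinity d ω) (_ : GromovBoundary.mk x = a)
    (_ : GromovBoundary.mk y = b),
    liminf (fun i : ℕ => ((gromovProduct d ω (x.1 i) (y.1 i) : ℝ) : EReal)) atTop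

/-- The ball `{b | exp (-(a, b)_ω) < r}`. -/
def gromovBall {X : Type*} (d : X → X → ℝ) (ω : X) (a : GromovBoundary d ω) (r : ℝ) :
    Set (GromovBoundary d ω) :=
  {b | EReal.exp (-(boundaryGromovProduct d ω a b)) < ENNReal.ofReal r}

/-- The canonical topology, for which the balls `gromovBall d ω a r`, `r > 0`, are a base of
neighbourhoods of `a`: a set is open iff it contains a ball around each of its points. -/
instance {X : Type*} (d : X → X → ℝ) (ω : X) : TopologicalSpace (GromovBoundary d ω) where
  IsOpen U := ∀ a ∈ U, ∃ r : ℝ, 0 < r ∧ gromovBall d ω a r ⊆ U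
  isOpen_univ := fun _ _ => ⟨1, one_pos, Set.subset_univ _⟩
  isOpen_inter := by
    rintro U V hU hV a ⟨haU, haV⟩
    obtain ⟨r, hr, hrU⟩ := hU a haU
    obtain ⟨s, hs, hsV⟩ := hV a haV
    refine ⟨min r s, lt_min hr hs, fun b hb => ⟨hrU ?_, hsV ?_⟩⟩
    · exact lt_of_lt_of_le hb (ENNReal.ofReal_le_ofReal (min_le_left _ _))
    · exact lt_of_lt_of_le hb (ENNReal.ofReal_le_ofReal (min_le_right _ _))
  isOpen_sUnion := by
    rintro S hS a ⟨U, hU, haU⟩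
    obtain ⟨r, hr, h⟩ := hS U hU a haU
    exact ⟨r, hr, h.trans (Set.subset_sUnion_of_mem hU)⟩

/-! ### Domains with `C^2` boundary -/

/-- `ρ` is a `C^2` defining function of `D` in the open neighbourhood `U` of `p`. -/
structure IsLocalDefiningFunction {N : ℕ} (D : Set (EuclideanSpace ℝ (Fin N)))
    (p : EuclideanSpace ℝ (Fin N)) (U : Set (EuclideanSpace ℝ (Fin N)))
    (ρ : EuclideanSpace ℝ (Fin N) → ℝ) : Prop where
  isOpen : IsOpen U
  mem : p ∈ U
  contDiffOn : ContDiffOn ℝ 2 ρ U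
  gradient_ne_zero : gradient ρ p ≠ 0
  inter_eq : D ∩ U = {q | q ∈ U ∧ ρ q < 0}

/-- The boundary of `D` is `C^2`-smooth. -/
def HasC2Boundary {N : ℕ} (D : Set (EuclideanSpace ℝ (Fin N))) : Prop :=
  ∀ p ∈ frontier D, ∃ U ρ, IsLocalDefiningFunction D p U ρ

/-- `n` is the outer unit normal to `D` at `p`. -/
def IsOuterNormal {N : ℕ} (D : Set (EuclideanSpace ℝ (Fin N)))
    (p n : EuclideanSpace ℝ (Fin N)) : Prop :=
  ∃ U ρ, IsLocalDefiningFunction D p U ρ ∧ n = ‖gradient ρ p‖⁻¹ • gradient ρ p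

/-! ### The construction of the metric -/

/-- The choices that enter the construction of the metric on `D`: a geodesic metric `dH` on the
boundary which induces the standard topology, a nearest point map `proj`, the outer unit normal
field `normal`, and a radius `ε` for which the interior ball condition holds. -/
structure ConstructionData {N : ℕ} (D : Set (EuclideanSpace ℝ (Fin N))) where
  dH : frontier D → frontier D → ℝ
  dH_isMetric : IsMetric dH
  dH_topology : InducesTopology dH
  dH_geodesic : IsGeodesic dH
  proj : D → frontier D
  dist_proj : ∀ x : D, dist (x : EuclideanSpace ℝ (Fin N)) (proj x) =
    Metric.infDist (x : EuclideanSpace ℝ (Fin N)) (frontier D)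
  normal : frontier D → EuclideanSpace ℝ (Fin N)
  isOuterNormal : ∀ p : frontier D, IsOuterNormal D p (normal p)
  ε : ℝ
  ε_pos : 0 < ε
  interior_ball : ∀ p : frontier D,
    Metric.closedBall ((p : EuclideanSpace ℝ (Fin N)) - ε • normal p) ε ⊆ insert ↑p D

namespace ConstructionData

variable {N : ℕ} {D : Set (EuclideanSpace ℝ (Fin N))} (c : ConstructionData D)

/-- The height of `x`: the square root of the Euclidean distance from `x` to the boundary. -/
def height (_c : ConstructionData D) (x : D) : ℝ :=
  √(Metric.infDist (x : EuclideanSpace ℝ (Fin N)) (frontier D))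

/-- `g(x, y) = 2 ln ((dH(π(x), π(y)) + max (h(x), h(y))) / √(h(x) h(y)))`. -/
def g (x y : D) : ℝ :=
  2 * Real.log ((c.dH (c.proj x) (c.proj y) + max (c.height x) (c.height y)) /
    √(c.height x * c.height y))

/-- The collar `D_ε` of points at distance at most `ε` from the boundary. -/
def collar : Set D := {x | c.height x ^ 2 ≤ c.ε}

theorem foot_mem (p : frontier D) :
    (p : EuclideanSpace ℝ (Fin N)) - c.ε • c.normal p ∈ D := by
  rcases c.interior_ball p (Metric.mem_closedBall_self c.ε_pos.le) with h | h
  · exfalso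
    obtain ⟨U, ρ, hρ, hn⟩ := c.isOuterNormal p
    have h0 : c.ε • c.normal p = 0 := by simpa using h
    rcases smul_eq_zero.1 h0 with h1 | h1
    · exact c.ε_pos.ne' h1
    · rw [hn] at h1
      rcases smul_eq_zero.1 h1 with h2 | h2
      · exact hρ.gradient_ne_zero (norm_eq_zero.1 (inv_eq_zero.1 h2))
      · exact hρ.gradient_ne_zero h2
  · exact h

/-- `x_ε = π(x) - ε n_{π(x)}`, the projection of `x` on the constricted boundary. -/
def foot (x : D) : D := ⟨_, c.foot_mem (c.proj x)⟩

/-- The infimum of the `g`-lengths of the paths from `x` to `y` inside the collar. -/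
def collarDist (x y : D) : ℝ :=
  (⨅ (γ : Path x y) (_ : ∀ t, γ t ∈ c.collar), pathLength c.g γ).toReal

open Classical in
/-- The metric on `D`. -/
def d (x y : D) : ℝ :=
  if x ∈ c.collar then
    if y ∈ c.collar then c.collarDist x y
    else c.collarDist x (c.foot y) + dist y (c.foot y)
  else
    if y ∈ c.collar then c.collarDist y (c.foot x) + dist x (c.foot x)
    else if c.proj x = c.proj y then dist x y
    else dist x (c.foot x) + c.collarDist (c.foot x) (c.foot y) + dist y (c.foot y)

end ConstructionData

end

/-! Write `E(x,y) = dH(π x, π y) + max (h x) (h y)`, so that `g(x,y) = 2 log E(x,y) - log h(x) - log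
h(y)`. On the collar, `π` and `h` are coordinates identifying it with the product of `∂D` and `(0,
√ε]`, and `g` is the Bonk–Schramm metric of a hyperbolic cone over `∂D`. Because `E` is symmetric,
positive and satisfies the triangle inequality, it satisfies a multiplicative four-point inequality
with constant 4 (`mul_le_four_mul_max`). Taking logarithms, the height terms cancel and `g` is
hyperbolic.

The metric `g` need not be geodesic, but its length metric exceeds it by at most a constant: one
goes up to a height comparable to `dH(π x, π y)`, follows a geodesic of `∂D` there, and comes down
(`exists_lipJoined_coneDist`). Since `g`-balls are compact, shortest curves exist, and the length
metric is geodesic. Outside the collar, `d` merely attaches normal segments of bounded length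
(`d_eq_whiskerDist`). Thus `d` is geodesic and at bounded distance from `g` composed with the
retraction onto the collar, hence hyperbolic.

The same estimate gives `(x,y)_ω = -log E(x,y) + O(1)`. A sequence therefore converges at infinity
exactly when its heights tend to 0 and its projections converge in `∂D`; two sequences are
equivalent when the limits agree; and `exp(-(a,b)_ω)` is comparable to `dH` of the limits. This
yields the homeomorphism (`exists_boundary_homeomorph`).

Smoothness enters through tangent inner balls: they make nearest points unique in the collar and put
every point on the inner normal at its projection. Such balls of a uniform radius come from the
Lipschitz derivative of a defining function and compactness; a metric `dH` comes from the length
metric of the Euclidean distance on the connected compact hypersurface `∂D`. -/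

noncomputable section

/-! ### Length metrics -/

section LengthMetric

variable {X : Type*} {ρ : X → X → ℝ}

theorem IsMetric.nonneg (hρ : IsMetric ρ) (x y : X) : 0 ≤ ρ x y := by
  have h1 := hρ.triangle x y x
  rw [hρ.self_eq_zero, hρ.symm y x] at h1
  linarith

/-- A curve that is `1`-Lipschitz for the distance function `ρ`. -/
def IsLipCurve (ρ : X → X → ℝ) (γ : ℝ → X) : Prop := ∀ s t, ρ (γ s) (γ t) ≤ |s - t|

/-- The points `x` and `y` are joined by a `1`-Lipschitz curve defined on `[0, ℓ]`. -/
def LipJoined (ρ : X → X → ℝ) (x y : X) (ℓ : ℝ) : Prop :=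
  ∃ γ : ℝ → X, IsLipCurve ρ γ ∧ γ 0 = x ∧ γ ℓ = y

/-- The length metric of `ρ`. -/
def intrinsicDist (ρ : X → X → ℝ) (x y : X) : ℝ := sInf {ℓ | 0 ≤ ℓ ∧ LipJoined ρ x y ℓ}

theorem IsLipCurve.of_le (hρ : IsMetric ρ) {γ : ℝ → X}
    (h : ∀ s t, s ≤ t → ρ (γ s) (γ t) ≤ t - s) : IsLipCurve ρ γ := by
  intro s t
  rcases le_total s t with hst | hst
  · rw [abs_of_nonpos (by linarith)]
    linarith [h s t hst]
  · rw [abs_of_nonneg (by linarith), hρ.symm]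
    exact h t s hst

theorem IsLipCurve.concat (hρ : IsMetric ρ) {γ₁ γ₂ : ℝ → X} (h₁ : IsLipCurve ρ γ₁)
    (h₂ : IsLipCurve ρ γ₂) {a : ℝ} (h : γ₁ a = γ₂ 0) :
    IsLipCurve ρ (fun t => if t ≤ a then γ₁ t else γ₂ (t - a)) := by
  refine IsLipCurve.of_le hρ fun s t hst => ?_
  by_cases hs : s ≤ a <;> by_cases ht : t ≤ a
  · simp only [hs, ht, if_true]
    exact (h₁ s t).trans (by rw [abs_of_nonpos] <;> linarith)
  · simp only [hs, ht, if_true, if_false]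
    have e1 := h₁ s a
    have e2 := h₂ 0 (t - a)
    rw [abs_of_nonpos (by linarith)] at e1 e2
    have := hρ.triangle (γ₁ s) (γ₁ a) (γ₂ (t - a))
    rw [h] at this e1
    linarith
  · exact absurd (hst.trans ht) hs
  · simp only [hs, ht, if_false]
    exact (h₂ _ _).trans (by rw [abs_of_nonpos] <;> linarith)

theorem LipJoined.refl (hρ : IsMetric ρ) (x : X) : LipJoined ρ x x 0 :=
  ⟨fun _ => x, fun s t => by simp [hρ.self_eq_zero], rfl, rfl⟩

theorem LipJoined.symm {x y : X} {ℓ : ℝ} (h : LipJoined ρ x y ℓ) : LipJoined ρ y x ℓ := by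
  obtain ⟨γ, hγ, h0, h1⟩ := h
  refine ⟨fun t => γ (ℓ - t), fun s t => (hγ _ _).trans ?_, by simpa, by simpa⟩
  rw [show ℓ - s - (ℓ - t) = t - s by ring, abs_sub_comm]

theorem LipJoined.trans (hρ : IsMetric ρ) {x y z : X} {ℓ₁ ℓ₂ : ℝ} (hℓ₁ : 0 ≤ ℓ₁) (hℓ₂ : 0 ≤ ℓ₂)
    (h₁ : LipJoined ρ x y ℓ₁) (h₂ : LipJoined ρ y z ℓ₂) : LipJoined ρ x z (ℓ₁ + ℓ₂) := by
  obtain ⟨γ₁, hγ₁, rfl, h1⟩ := h₁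
  obtain ⟨γ₂, hγ₂, h2, rfl⟩ := h₂
  refine ⟨_, hγ₁.concat hρ hγ₂ (h1.trans h2.symm), by simp [hℓ₁], ?_⟩
  rcases hℓ₂.eq_or_lt with rfl | h
  · simp [h1, h2]
  · simp [h]

theorem IsLipCurve.lipJoined {γ : ℝ → X} (hγ : IsLipCurve ρ γ) (s t : ℝ) :
    LipJoined ρ (γ s) (γ t) |s - t| := by
  have key : ∀ s t, s ≤ t → LipJoined ρ (γ s) (γ t) |s - t| := fun s t hst => by
    refine ⟨fun u => γ (s + u), fun u v => (hγ _ _).trans (by simp), by simp, ?_⟩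
    rw [abs_of_nonpos (by linarith)]
    simp
  rcases le_total s t with h | h
  · exact key s t h
  · rw [abs_sub_comm]
    exact (key t s h).symm

theorem lipJoined_of_Icc {γ : ℝ → X} {a b K : ℝ} (hab : a ≤ b) (hK : 0 < K)
    (h : ∀ s ∈ Set.Icc a b, ∀ t ∈ Set.Icc a b, ρ (γ s) (γ t) ≤ K * |s - t|) :
    LipJoined ρ (γ a) (γ b) (K * (b - a)) := by
  -- Curves are required to be Lipschitz on all of `ℝ`: the parameter is slowed down by `K` and
  -- clamped to `[a, b]`.
  refine ⟨fun u => γ (Set.projIcc a b hab (a + u / K)), fun s t => ?_, ?_, ?_⟩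
  · refine (h _ (Subtype.property _) _ (Subtype.property _)).trans ?_
    have h1 := Set.abs_projIcc_sub_projIcc (c := a + s / K) (d := a + t / K) hab
    calc _ ≤ K * |a + s / K - (a + t / K)| := by gcongr
      _ = |s - t| := by
        rw [show a + s / K - (a + t / K) = (s - t) / K by ring, abs_div, abs_of_pos hK]
        field_simp
  · simp
  · have h2 : a + K * (b - a) / K = b := by field_simp; ring
    simp [h2]

theorem intrinsicDist_le {x y : X} {ℓ : ℝ} (hℓ : 0 ≤ ℓ) (h : LipJoined ρ x y ℓ) :
    intrinsicDist ρ x y ≤ ℓ :=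
  csInf_le ⟨0, fun _ h => h.1⟩ ⟨hℓ, h⟩

theorem intrinsicDist_nonneg (x y : X) : 0 ≤ intrinsicDist ρ x y :=
  Real.sInf_nonneg fun _ h => h.1

theorem LipJoined.le {x y : X} {ℓ : ℝ} (hℓ : 0 ≤ ℓ) (h : LipJoined ρ x y ℓ) : ρ x y ≤ ℓ := by
  obtain ⟨γ, hγ, rfl, rfl⟩ := h
  simpa [abs_of_nonneg hℓ] using hγ 0 ℓ

/-- Joinability is needed because the infimum of the empty set is 0 by convention. -/
theorem le_intrinsicDist {x y : X} (h : ∃ ℓ, 0 ≤ ℓ ∧ LipJoined ρ x y ℓ) :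
    ρ x y ≤ intrinsicDist ρ x y :=
  le_csInf h fun _ hℓ => hℓ.2.le hℓ.1

theorem intrinsicDist_self (hρ : IsMetric ρ) (x : X) : intrinsicDist ρ x x = 0 :=
  le_antisymm (intrinsicDist_le le_rfl (LipJoined.refl hρ x)) (intrinsicDist_nonneg _ _)

theorem isMetric_intrinsicDist (hρ : IsMetric ρ)
    (hJ : ∀ x y, ∃ ℓ, 0 ≤ ℓ ∧ LipJoined ρ x y ℓ) : IsMetric (intrinsicDist ρ) where
  self_eq_zero := intrinsicDist_self hρ
  eq_of_eq_zero x y h := hρ.eq_of_eq_zero x y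
    (le_antisymm (h ▸ le_intrinsicDist (hJ x y)) (hρ.nonneg x y))
  symm x y := by
    unfold intrinsicDist
    congr 1
    ext ℓ
    exact ⟨fun h => ⟨h.1, h.2.symm⟩, fun h => ⟨h.1, h.2.symm⟩⟩
  triangle x y z := by
    refine le_of_forall_pos_le_add fun e he => ?_
    obtain ⟨ℓ₁, h1, h1'⟩ := exists_lt_of_csInf_lt (hJ x y)
      (show intrinsicDist ρ x y < intrinsicDist ρ x y + e / 2 by linarith)
    obtain ⟨ℓ₂, h2, h2'⟩ := exists_lt_of_csInf_lt (hJ y z)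
      (show intrinsicDist ρ y z < intrinsicDist ρ y z + e / 2 by linarith)
    have := intrinsicDist_le (add_nonneg h1.1 h2.1) (h1.2.trans hρ h1.1 h2.1 h2.2)
    linarith

/-- In a space with compact balls the infimum in the length metric is attained. -/
theorem lipJoined_intrinsicDist [TopologicalSpace X] (hρ : IsMetric ρ)
    (hc : Continuous fun p : X × X => ρ p.1 p.2) (hK : ∀ x R, IsCompact {y | ρ x y ≤ R})
    {x y : X} (hJ : ∃ ℓ, 0 ≤ ℓ ∧ LipJoined ρ x y ℓ) :
    LipJoined ρ x y (intrinsicDist ρ x y) := by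
  obtain ⟨ℓ, -, hℓ, hmem⟩ := exists_seq_tendsto_sInf (S := {ℓ | 0 ≤ ℓ ∧ LipJoined ρ x y ℓ}) hJ
    ⟨0, fun _ h => h.1⟩
  change Tendsto ℓ atTop (𝓝 (intrinsicDist ρ x y)) at hℓ
  set L := intrinsicDist ρ x y
  choose h0 γ hγ hγ0 hγ1 using hmem
  -- Pointwise limits along an ultrafilter replace Arzelà–Ascoli: at time `t` all curves lie in the
  -- compact ball of radius `|t|` about `x`, and the 1-Lipschitz condition passes to pointwise
  -- limits.
  let F : Ultrafilter ℕ := hyperfilter ℕ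
  have hF : (F : Filter ℕ) ≤ atTop := Nat.hyperfilter_le_atTop
  have hex : ∀ t, ∃ z, Tendsto (fun n => γ n t) F (𝓝 z) := fun t => by
    obtain ⟨z, -, hz⟩ := (hK x |t|).ultrafilter_le_nhds (F.map fun n => γ n t) (by
      rw [le_principal_iff, Ultrafilter.coe_map, mem_map]
      refine Filter.univ_mem' fun n => ?_
      have := hγ n 0 t
      rw [hγ0] at this
      simpa using this)
    exact ⟨z, hz⟩
  choose Γ hΓ using hex
  have hlim : ∀ s t, Tendsto (fun n => ρ (γ n s) (γ n t)) F (𝓝 (ρ (Γ s) (Γ t))) := fun s t =>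
    (hc.tendsto (Γ s, Γ t)).comp ((hΓ s).prodMk_nhds (hΓ t))
  refine ⟨Γ, fun s t => le_of_tendsto (hlim s t) (Eventually.of_forall fun n => hγ n s t), ?_, ?_⟩
  · refine hρ.eq_of_eq_zero _ _ (tendsto_nhds_unique
      ((hc.tendsto (Γ 0, x)).comp ((hΓ 0).prodMk_nhds tendsto_const_nhds)) ?_)
    refine tendsto_const_nhds.congr fun n => ?_
    simp [hγ0, hρ.self_eq_zero]
  · refine hρ.eq_of_eq_zero _ _ (tendsto_nhds_unique
      ((hc.tendsto (Γ L, y)).comp ((hΓ L).prodMk_nhds tendsto_const_nhds)) ?_)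
    refine squeeze_zero (fun n => hρ.nonneg _ _) (fun n => ?_)
      (show Tendsto (fun n => |L - ℓ n|) F (𝓝 0) from ?_)
    · have := hγ n L (ℓ n)
      rwa [hγ1] at this
    · have := (tendsto_const_nhds (x := L)).sub (hℓ.mono_left hF)
      simpa using this.abs

/-- A `1`-Lipschitz curve whose endpoints realize its length is a geodesic segment. -/
theorem geodesic_of_lipJoined (hρ : IsMetric ρ) {x y : X} (h : LipJoined ρ x y (ρ x y)) :
    ∃ γ : ℝ → X, γ 0 = x ∧ γ (ρ x y) = y ∧
      ∀ s ∈ Set.Icc 0 (ρ x y), ∀ t ∈ Set.Icc 0 (ρ x y), ρ (γ s) (γ t) = |s - t| := by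
  obtain ⟨γ, hγ, h0, h1⟩ := h
  refine ⟨γ, h0, h1, ?_⟩
  have key : ∀ s ∈ Set.Icc 0 (ρ x y), ∀ t ∈ Set.Icc 0 (ρ x y), s ≤ t →
      |s - t| ≤ ρ (γ s) (γ t) := fun s hs t ht hst => by
    have e1 := hγ 0 s
    have e2 := hγ t (ρ x y)
    have e3 := hρ.triangle x (γ s) y
    have e4 := hρ.triangle (γ s) (γ t) y
    rw [h0, abs_of_nonpos (by linarith [hs.1])] at e1
    rw [h1, abs_of_nonpos (by linarith [ht.2])] at e2
    rw [abs_of_nonpos (by linarith)]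
    linarith
  intro s hs t ht
  refine le_antisymm (hγ s t) ?_
  rcases le_total s t with hst | hst
  · exact key s hs t ht hst
  · rw [abs_sub_comm, hρ.symm]
    exact key t ht s hs hst

theorem isGeodesic_of_lipJoined (hρ : IsMetric ρ) (h : ∀ x y, LipJoined ρ x y (ρ x y)) :
    IsGeodesic ρ := fun x y => geodesic_of_lipJoined hρ (h x y)

/-- A `1`-Lipschitz curve for `ρ` is also one for the length metric of `ρ`. -/
theorem LipJoined.intrinsic {x y : X} {ℓ : ℝ} (h : LipJoined ρ x y ℓ) :
    LipJoined (intrinsicDist ρ) x y ℓ := by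
  obtain ⟨γ, hγ, h0, h1⟩ := h
  exact ⟨γ, fun s t => intrinsicDist_le (abs_nonneg _) (hγ.lipJoined s t), h0, h1⟩

end LengthMetric

/-! ### Lengths of paths -/

section PathLength

/-- A continuous curve of finite variation can be reparametrized by arc length. -/
theorem exists_lipschitz_reparametrization {E : Type*} [PseudoMetricSpace E] {f : unitInterval → E}
    (hf : Continuous f) (hv : BoundedVariationOn f Set.univ) :
    ∃ γ : ℝ → E, (∀ s t, dist (γ s) (γ t) ≤ |s - t|) ∧ dist (γ 0) (f 0) = 0 ∧
      γ (eVariationOn f Set.univ).toReal = f 1 := by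
  have hl := hv.locallyBoundedVariationOn
  set v : unitInterval → ℝ := variationOnFromTo f Set.univ 0 with hvdef
  have hmono : Monotone v := fun s t hst =>
    variationOnFromTo.monotoneOn hl (Set.mem_univ 0) (Set.mem_univ s) (Set.mem_univ t) hst
  have hdist : ∀ s t, s ≤ t → dist (f s) (f t) ≤ v t - v s := fun s t hst => by
    have h1 : v t - v s = variationOnFromTo f Set.univ s t := by
      have := variationOnFromTo.add hl (Set.mem_univ 0) (Set.mem_univ s) (Set.mem_univ t)
      simp only [hvdef]
      linarith
    rw [h1, variationOnFromTo.eq_of_le _ _ hst, dist_edist]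
    refine ENNReal.toReal_mono (hl s t (Set.mem_univ _) (Set.mem_univ _)) ?_
    exact eVariationOn.edist_le f ⟨Set.mem_univ _, Set.left_mem_Icc.2 hst⟩
      ⟨Set.mem_univ _, Set.right_mem_Icc.2 hst⟩
  have hv0 : v 0 = 0 := variationOnFromTo.self _ _ _
  have hv1 : v 1 = (eVariationOn f Set.univ).toReal := by
    rw [hvdef, variationOnFromTo.eq_of_le _ _ zero_le_one]
    congr 2
    ext t
    simp [unitInterval.le_one']
  -- A generalized inverse of the variation `v`. It may jump, but strictly between `τ s` and `τ s'`
  -- the values of `v` lie in `(s, s']`, so `f` moves there by at most `s' - s`; continuity of `f`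
  -- extends the bound to the endpoints.
  set τ : ℝ → unitInterval := fun s => sSup {t | v t ≤ s} with hτ
  have hτmono : Monotone τ := fun s t hst => sSup_le_sSup fun u hu => le_trans hu hst
  have hIoo : ∀ s s', s ≤ s' → ∀ t t', t ≤ t' → t ∈ Set.Ioo (τ s) (τ s') →
      t' ∈ Set.Ioo (τ s) (τ s') → dist (f t) (f t') ≤ s' - s := by
    intro s s' _ t t' htt' ht ht'
    have h1 : s < v t := by
      by_contra! h
      exact absurd (le_sSup (show t ∈ {t | v t ≤ s} from h)) (not_le.2 ht.1)
    obtain ⟨u, hu, hu'⟩ := lt_sSup_iff.1 ht'.2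
    have h2 : v t' ≤ s' := (hmono hu'.le).trans hu
    linarith [hdist t t' htt']
  have hlip : ∀ s s', s ≤ s' → dist (f (τ s)) (f (τ s')) ≤ s' - s := by
    intro s s' hss'
    rcases (hτmono hss').eq_or_lt with h | h
    · rw [h, dist_self]
      linarith
    · have hcl : closure (Set.Ioo (τ s) (τ s') ×ˢ Set.Ioo (τ s) (τ s')) ⊆
          {p : unitInterval × unitInterval | dist (f p.1) (f p.2) ≤ s' - s} := by
        refine closure_minimal ?_ (isClosed_le (by fun_prop) continuous_const)
        rintro ⟨t, t'⟩ ⟨ht, ht'⟩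
        rcases le_total t t' with h1 | h1
        · exact hIoo s s' hss' t t' h1 ht ht'
        · change dist (f t) (f t') ≤ _
          rw [dist_comm]
          exact hIoo s s' hss' t' t h1 ht' ht
      rw [closure_prod_eq, closure_Ioo h.ne] at hcl
      exact hcl (Set.mk_mem_prod (Set.left_mem_Icc.2 h.le) (Set.right_mem_Icc.2 h.le))
  refine ⟨fun s => f (τ s), fun s t => ?_, ?_, ?_⟩
  · rcases le_total s t with h | h
    · rw [abs_of_nonpos (by linarith)]
      linarith [hlip s t h]
    · rw [abs_of_nonneg (by linarith), dist_comm]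
      exact hlip t s h
  -- If `f` is constant at first, `τ 0` is positive; still `f` stays at distance 0 from `f 0` up to
  -- that time.
  · have hcl : closure {t | v t ≤ 0} ⊆ {t | dist (f t) (f 0) = 0} := by
      refine closure_minimal (fun t ht => ?_)
        (isClosed_eq (by fun_prop) continuous_const)
      have := hdist 0 t t.2.1
      have ht : v t ≤ 0 := ht
      rw [dist_comm] at this
      exact le_antisymm (by linarith) dist_nonneg
    exact hcl ((isLUB_sSup {t | v t ≤ 0}).mem_closure ⟨0, hv0.le⟩)
  · have : τ (eVariationOn f Set.univ).toReal = 1 :=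
      le_antisymm le_top (le_sSup (show v 1 ≤ _ from hv1.le))
    simp only [this]

variable {X : Type*} {ρ : X → X → ℝ}

/-- The pseudometric space structure given by a distance function. -/
abbrev IsMetric.toPseudoMetricSpace (hρ : IsMetric ρ) : PseudoMetricSpace X where
  dist := ρ
  dist_self := hρ.self_eq_zero
  dist_comm := hρ.symm
  dist_triangle := hρ.triangle

/-- The `ρ`-length is the variation for the pseudometric `ρ`, so arc length parametrization applies.
Continuity is phrased through `ρ`, as `X` carries no other topology here. -/
theorem lipJoined_of_pathLength (hρ : IsMetric ρ) {f : unitInterval → X}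
    (hf : ∀ t, Tendsto (fun s => ρ (f s) (f t)) (𝓝 t) (𝓝 0)) (h : pathLength ρ f ≠ ⊤) :
    LipJoined ρ (f 0) (f 1) (pathLength ρ f).toReal := by
  let _ := hρ.toPseudoMetricSpace
  have hv : eVariationOn f Set.univ = pathLength ρ f := by
    refine le_antisymm (iSup_le fun p => ?_) (iSup_le fun n => iSup_le fun t => iSup_le fun ht => ?_)
    · refine le_iSup_of_le p.1 (le_iSup_of_le p.2.1 (le_iSup_of_le p.2.2.1 ?_))
      refine Finset.sum_le_sum fun i _ => ?_
      rw [edist_comm, edist_dist]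
      rfl
    · refine le_trans (Finset.sum_le_sum fun i _ => ?_)
        (eVariationOn.sum_le (n := n) ht fun i => Set.mem_univ _)
      rw [edist_comm, edist_dist]
      rfl
  have hc : Continuous f := continuous_iff_continuousAt.2 fun t => tendsto_iff_dist_tendsto_zero.2 (hf t)
  obtain ⟨γ, hγ, h0, h1⟩ := exists_lipschitz_reparametrization hc (by rwa [BoundedVariationOn, hv])
  rw [hv] at h1
  exact ⟨γ, hγ, hρ.eq_of_eq_zero _ _ h0, h1⟩

theorem pathLength_le {f : unitInterval → X} {ℓ : ℝ}
    (h : ∀ s t, s ≤ t → ρ (f s) (f t) ≤ ℓ * (t - s)) (hℓ : 0 ≤ ℓ) :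
    pathLength ρ f ≤ ENNReal.ofReal ℓ := by
  refine iSup_le fun n => iSup_le fun t => iSup_le fun ht => ?_
  have h1 : ∀ i : ℕ, 0 ≤ ℓ * ((t (i + 1) : ℝ) - t i) := fun i =>
    mul_nonneg hℓ (sub_nonneg.2 (ht (Nat.le_succ i)))
  calc _ ≤ ∑ i ∈ Finset.range n, ENNReal.ofReal (ℓ * ((t (i + 1) : ℝ) - t i)) :=
        Finset.sum_le_sum fun i _ => ENNReal.ofReal_le_ofReal (h _ _ (ht (Nat.le_succ i)))
    _ = ENNReal.ofReal (ℓ * ((t n : ℝ) - t 0)) := by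
        rw [← ENNReal.ofReal_sum_of_nonneg fun i _ => h1 i, ← Finset.mul_sum,
          Finset.sum_range_sub (fun i => (t i : ℝ))]
    _ ≤ ENNReal.ofReal ℓ := by
        refine ENNReal.ofReal_le_ofReal (mul_le_of_le_one_right hℓ ?_)
        linarith [(t n).2.2, (t 0).2.1]

/-- A cluster point of `u` in `K` is mapped by `φ` to a cluster point of a family converging to `φ
x`, so it is `x`; in a compact set a unique cluster point is a limit. -/
theorem tendsto_of_tendsto_comp {X Y ι : Type*} [TopologicalSpace X] [TopologicalSpace Y] [T2Space Y]
    {K : Set X} (hK : IsCompact K) {φ : X → Y} (hφ : Continuous φ) {l : Filter ι} {u : ι → X}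
    {x : X} (huK : ∀ᶠ i in l, u i ∈ K) (h : Tendsto (fun i => φ (u i)) l (𝓝 (φ x)))
    (hx : ∀ y ∈ K, φ y = φ x → y = x) : Tendsto u l (𝓝 x) := by
  refine hK.tendsto_nhds_of_unique_mapClusterPt huK fun y hyK hy => hx y hyK ?_
  have h1 : MapClusterPt (φ y) l (fun i => φ (u i)) := hy.continuousAt_comp hφ.continuousAt
  exact eq_of_nhds_neBot (NeBot.mono h1 (inf_le_inf le_rfl h))

/-- In a space with compact balls, convergence for `ρ` implies convergence for the topology. -/
theorem tendsto_of_dist_tendsto_zero [TopologicalSpace X] (hρ : IsMetric ρ)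
    (hc : Continuous fun p : X × X => ρ p.1 p.2) (hK : ∀ x R, IsCompact {y | ρ x y ≤ R})
    {ι : Type*} {l : Filter ι} {u : ι → X} {x : X} (h : Tendsto (fun i => ρ x (u i)) l (𝓝 0)) :
    Tendsto u l (𝓝 x) := by
  refine tendsto_of_tendsto_comp (φ := fun y => ρ x y) (hK x 1)
    (hc.comp (continuous_const.prodMk continuous_id)) ?_ ?_ fun y _ hy => ?_
  · filter_upwards [h.eventually_lt_const one_pos] with i hi using hi.le
  · simpa [hρ.self_eq_zero] using h
  · rw [hρ.self_eq_zero] at hy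
    exact (hρ.eq_of_eq_zero x y hy).symm

end PathLength

/-! ### The hyperbolic cone over a metric space -/

section Cone

variable {X Z : Type*} {dH : Z → Z → ℝ} {π : X → Z} {h : X → ℝ}

/-- The quantity `dH (π x) (π y) + max (h x) (h y)`, which measures the distance of `x` and `y` as
seen from the top of the cone. -/
def coneGauge (dH : Z → Z → ℝ) (π : X → Z) (h : X → ℝ) (x y : X) : ℝ :=
  dH (π x) (π y) + max (h x) (h y)

/-- The Bonk–Schramm metric of a hyperbolic cone over `Z`. -/
def coneDist (dH : Z → Z → ℝ) (π : X → Z) (h : X → ℝ) (x y : X) : ℝ :=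
  2 * Real.log (coneGauge dH π h x y / √(h x * h y))

theorem coneGauge_pos (hZ : IsMetric dH) (hh : ∀ x, 0 < h x) (x y : X) :
    0 < coneGauge dH π h x y :=
  add_pos_of_nonneg_of_pos (hZ.nonneg _ _) (lt_max_of_lt_left (hh x))

theorem coneGauge_comm (hZ : IsMetric dH) (x y : X) :
    coneGauge dH π h x y = coneGauge dH π h y x := by
  simp only [coneGauge, hZ.symm (π x), max_comm (h x)]

theorem coneGauge_triangle (hZ : IsMetric dH) (hh : ∀ x, 0 < h x) (x y z : X) :
    coneGauge dH π h x z ≤ coneGauge dH π h x y + coneGauge dH π h y z := by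
  have h1 := hZ.triangle (π x) (π y) (π z)
  have h2 : max (h x) (h z) ≤ max (h x) (h y) + max (h y) (h z) :=
    max_le ((le_max_left _ _).trans (le_add_of_nonneg_right ((hh y).le.trans (le_max_left _ _))))
      ((le_max_right _ _).trans (le_add_of_nonneg_left ((hh y).le.trans (le_max_right _ _))))
  unfold coneGauge
  linarith

theorem coneDist_eq (hZ : IsMetric dH) (hh : ∀ x, 0 < h x) (x y : X) :
    coneDist dH π h x y =
      2 * Real.log (coneGauge dH π h x y) - Real.log (h x) - Real.log (h y) := by
  have hx := hh x
  have hy := hh y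
  rw [coneDist, Real.log_div (coneGauge_pos hZ hh x y).ne' (Real.sqrt_pos.2 (mul_pos hx hy)).ne',
    Real.log_sqrt (mul_pos hx hy).le, Real.log_mul hx.ne' hy.ne']
  ring

theorem abs_log_sub_log_le_coneDist (hZ : IsMetric dH) (hh : ∀ x, 0 < h x) (x y : X) :
    |Real.log (h x) - Real.log (h y)| ≤ coneDist dH π h x y := by
  have h1 : Real.log (h x) ≤ Real.log (coneGauge dH π h x y) :=
    Real.log_le_log (hh x) (le_add_of_nonneg_of_le (hZ.nonneg _ _) (le_max_left _ _))
  have h2 : Real.log (h y) ≤ Real.log (coneGauge dH π h x y) :=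
    Real.log_le_log (hh y) (le_add_of_nonneg_of_le (hZ.nonneg _ _) (le_max_right _ _))
  rw [coneDist_eq hZ hh, abs_le]
  constructor <;> linarith

/-- With `E` the gauge, the triangle inequality for `2 log E - log h - log h` amounts to `E(x,z)
h(y) ≤ E(x,y) E(y,z)`, which follows by expanding the product. If the distance vanishes, the heights
agree first, and then `dH = 0`. -/
theorem isMetric_coneDist (hZ : IsMetric dH) (hh : ∀ x, 0 < h x)
    (hinj : ∀ x y, π x = π y → h x = h y → x = y) : IsMetric (coneDist dH π h) where
  self_eq_zero x := by
    rw [coneDist_eq hZ hh]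
    simp only [coneGauge, hZ.self_eq_zero, max_self, zero_add]
    ring
  eq_of_eq_zero x y h0 := by
    have h1 := abs_log_sub_log_le_coneDist (π := π) hZ hh x y
    rw [h0, abs_nonpos_iff, sub_eq_zero] at h1
    have h2 := Real.log_injOn_pos (hh x) (hh y) h1
    refine hinj x y (hZ.eq_of_eq_zero _ _ ?_) h2
    rw [coneDist_eq hZ hh, ← h1] at h0
    have h3 := Real.log_injOn_pos (coneGauge_pos hZ hh x y) (hh x)
      (show Real.log (coneGauge dH π h x y) = _ by linarith)
    simpa [coneGauge, h2] using h3
  symm x y := by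
    rw [coneDist_eq hZ hh, coneDist_eq hZ hh, coneGauge_comm hZ]
    ring
  triangle x y z := by
    have hx := hh x
    have hy := hh y
    have hz := hh z
    have hxy := coneGauge_pos (π := π) hZ hh x y
    have hyz := coneGauge_pos (π := π) hZ hh y z
    have hxz := coneGauge_pos (π := π) hZ hh x z
    have key : coneGauge dH π h x z * h y ≤ coneGauge dH π h x y * coneGauge dH π h y z := by
      have t := hZ.triangle (π x) (π y) (π z)
      have n1 := hZ.nonneg (π x) (π y)
      have n2 := hZ.nonneg (π y) (π z)
      have e1 : max (h x) (h z) * h y ≤ max (h x) (h y) * max (h y) (h z) := by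
        rcases max_choice (h x) (h z) with e | e <;> rw [e]
        · exact mul_le_mul (le_max_left _ _) (le_max_left _ _) hy.le
            (hx.le.trans (le_max_left _ _))
        · rw [mul_comm]
          exact mul_le_mul (le_max_right _ _) (le_max_right _ _) hz.le
            (hx.le.trans (le_max_left _ _))
      have e2 := mul_le_mul_of_nonneg_left (le_max_left (h y) (h z)) n1
      have e3 := mul_le_mul_of_nonneg_left (le_max_right (h x) (h y)) n2
      have e4 := mul_le_mul_of_nonneg_right t hy.le
      have e5 := mul_nonneg n1 n2
      unfold coneGauge
      linarith
    have := Real.log_le_log (mul_pos hxz hy) key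
    rw [Real.log_mul hxz.ne' hy.ne', Real.log_mul hxy.ne' hyz.ne'] at this
    simp only [coneDist_eq hZ hh]
    linarith

/-- On the 4-cycle `x z y t`, pick a side not longer than its two neighbours, say `xz`. The triangle
inequality through it gives `E x y ≤ 2 E y z` and `E z t ≤ 2 E x t`; multiply. `E x x = 0` is never
needed. -/
theorem mul_le_four_mul_max {X : Type*} {E : X → X → ℝ} (h0 : ∀ x y, 0 < E x y)
    (hs : ∀ x y, E x y = E y x) (ht : ∀ x y z, E x z ≤ E x y + E y z) (x y z t : X) :
    E x y * E z t ≤ 4 * max (E x z * E y t) (E x t * E y z) := by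
  have key : ∀ x y z t, E x z ≤ E z y → E x z ≤ E x t → E x y * E z t ≤ 4 * (E x t * E y z) := by
    intro x y z t h1 h2
    have e1 : E x y ≤ 2 * E y z := by linarith [ht x z y, hs y z]
    have e2 : E z t ≤ 2 * E x t := by linarith [ht z x t, hs z x]
    calc _ ≤ 2 * E y z * (2 * E x t) :=
          mul_le_mul e1 e2 (h0 _ _).le (mul_nonneg zero_le_two (h0 _ _).le)
      _ = _ := by ring
  have m1 := le_max_left (E x z * E y t) (E x t * E y z)
  have m2 := le_max_right (E x z * E y t) (E x t * E y z)
  by_cases c1 : E x z ≤ E z y ∧ E x z ≤ E x t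
  · linarith [key x y z t c1.1 c1.2]
  by_cases c2 : E y t ≤ E t x ∧ E y t ≤ E y z
  · have := key y x t z c2.1 c2.2
    rw [hs y x, hs t z, mul_comm (E y z)] at this
    linarith
  by_cases c3 : E x t ≤ E t y ∧ E x t ≤ E x z
  · have := key x y t z c3.1 c3.2
    rw [hs t z] at this
    linarith
  have c4 : E y z ≤ E z x ∧ E y z ≤ E y t := by
    rw [hs t x] at c2
    rw [hs t y] at c3
    rw [hs z y] at c1
    rw [hs z x]
    by_contra c4
    simp only [not_and_or, not_le] at c1 c2 c3 c4
    rcases c1 with c1 | c1 <;> rcases c2 with c2 | c2 <;> rcases c3 with c3 | c3 <;>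
      rcases c4 with c4 | c4 <;> linarith
  have := key y x z t c4.1 c4.2
  rw [hs y x, mul_comm (E y t)] at this
  linarith

/-- Each of the three sums contains every `log h` exactly once, so only the logarithms of the gauge
products are compared. -/
theorem coneDist_four_point (hZ : IsMetric dH) (hh : ∀ x, 0 < h x) (x y z t : X) :
    coneDist dH π h x y + coneDist dH π h z t ≤
      max (coneDist dH π h x z + coneDist dH π h y t)
        (coneDist dH π h x t + coneDist dH π h y z) + 2 * Real.log 4 := by
  have h0 := coneGauge_pos (π := π) hZ hh
  have := mul_le_four_mul_max h0 (coneGauge_comm hZ) (coneGauge_triangle hZ hh) x y z t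
  simp only [coneDist_eq hZ hh]
  rw [mul_max_of_nonneg _ _ (by norm_num), le_max_iff] at this
  rw [← sub_le_iff_le_add, le_max_iff]
  refine this.imp (fun H => ?_) fun H => ?_
  all_goals
    replace H := Real.log_le_log (mul_pos (h0 _ _) (h0 _ _)) H
    rw [Real.log_mul (h0 _ _).ne' (h0 _ _).ne', Real.log_mul (by norm_num)
      (mul_pos (h0 _ _) (h0 _ _)).ne', Real.log_mul (h0 _ _).ne' (h0 _ _).ne'] at H
    linarith

/-- The cone metric is, up to an additive constant, a length metric. -/
theorem exists_lipJoined_coneDist (hZ : IsMetric dH) (hgeo : IsGeodesic dH) {Δ H : ℝ}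
    (hΔ : ∀ p q, dH p q ≤ Δ) (hH : 0 < H) (hh : ∀ x, 0 < h x) (hhH : ∀ x, h x ≤ H)
    (hinj : ∀ x y, π x = π y → h x = h y → x = y)
    (hsurj : ∀ p, ∀ k, 0 < k → k ≤ H → ∃ x, π x = p ∧ h x = k) (x y : X) :
    ∃ ℓ, 0 ≤ ℓ ∧ LipJoined (coneDist dH π h) x y ℓ ∧
      ℓ ≤ coneDist dH π h x y + 2 * (1 + Δ / H) := by
  have hg := isMetric_coneDist (π := π) hZ hh hinj
  -- On a vertical line the cone distance is exactly `|log h - log h'|`, so `log h` is an arc length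
  -- parameter.
  have vert : ∀ x y, π x = π y → h x ≤ h y →
      LipJoined (coneDist dH π h) x y (Real.log (h y) - Real.log (h x)) := by
    intro x y hπ hle
    have hlog := Real.log_le_log (hh x) hle
    have : Nonempty X := ⟨x⟩
    choose! P hP using fun s (hs : s ≤ Real.log (h y)) => hsurj (π x) (Real.exp s) (Real.exp_pos s)
      (by rw [← Real.le_log_iff_exp_le (hH)]; exact hs.trans (Real.log_le_log (hh y) (hhH y)))
    have e : ∀ z, π z = π x → h z ≤ h y → P (Real.log (h z)) = z := fun z h1 h2 => by
      have := hP (Real.log (h z)) (Real.log_le_log (hh z) h2)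
      rw [Real.exp_log (hh z)] at this
      exact hinj _ _ (this.1.trans h1.symm) this.2
    have := lipJoined_of_Icc (ρ := coneDist dH π h) (γ := P) hlog one_pos (fun s hs t ht => by
      rw [coneDist_eq hZ hh, coneGauge]
      rw [(hP s hs.2).1, (hP t ht.2).1, (hP s hs.2).2, (hP t ht.2).2, hZ.self_eq_zero, zero_add,
        Real.log_exp, Real.log_exp]
      rcases le_total s t with hst | hst
      · rw [max_eq_right (Real.exp_le_exp.2 hst), Real.log_exp, abs_of_nonpos (by linarith)]
        linarith
      · rw [max_eq_left (Real.exp_le_exp.2 hst), Real.log_exp, abs_of_nonneg (by linarith)]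
        linarith)
    rw [e x rfl hle, e y hπ.symm le_rfl] at this
    simpa using this
  set a := dH (π x) (π y) with ha
  have ha0 : 0 ≤ a := hZ.nonneg _ _
  -- The height at which to travel sideways: high enough for `a / m` to be bounded, yet at most the
  -- gauge of `x` and `y`, so that the two vertical pieces cost at most `coneDist x y`. The cap `H`
  -- keeps it inside the cone.
  set m := max (max (h x) (h y)) (min a H) with hm
  have hm0 : 0 < m := lt_max_of_lt_left (lt_max_of_lt_left (hh x))
  have hmH : m ≤ H := max_le (max_le (hhH x) (hhH y)) (min_le_right _ _)
  have hxm : h x ≤ m := (le_max_left _ _).trans (le_max_left _ _)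
  have hym : h y ≤ m := (le_max_right _ _).trans (le_max_left _ _)
  obtain ⟨x', hx'π, hx'⟩ := hsurj (π x) m hm0 hmH
  obtain ⟨y', hy'π, hy'⟩ := hsurj (π y) m hm0 hmH
  have j1 := vert x x' hx'π.symm (by rw [hx']; exact hxm)
  have j3 := (vert y y' hy'π.symm (by rw [hy']; exact hym)).symm
  -- At constant height `m`, points at `dH`-distance `r` are at cone distance `2 log (1 + r/m) ≤
  -- 2r/m`.
  have j2 : LipJoined (coneDist dH π h) x' y' (2 / m * (a - 0)) := by
    obtain ⟨γ, h0, h1, hγ⟩ := hgeo (π x) (π y)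
    choose P hP using fun p => hsurj p m hm0 hmH
    have := lipJoined_of_Icc (ρ := coneDist dH π h) (γ := fun s => P (γ s)) ha0
      (K := 2 / m) (by positivity) (fun s hs t ht => by
        rw [coneDist_eq hZ hh, coneGauge, (hP _).1, (hP _).1, (hP _).2, (hP _).2, hγ s hs t ht,
          max_self]
        have p1 : 0 < |s - t| + m := by positivity
        have h3 := Real.log_le_sub_one_of_pos (div_pos p1 hm0)
        rw [Real.log_div p1.ne' hm0.ne'] at h3
        have h4 : (|s - t| + m) / m - 1 = |s - t| / m := by field_simp; ring
        have h5 : 2 / m * |s - t| = 2 * (|s - t| / m) := by ring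
        linarith)
    simp only [h0, show γ a = π y from h1] at this
    rwa [hinj x' (P (π x)) (hx'π.trans (hP _).1.symm) (hx'.trans (hP _).2.symm),
      hinj y' (P (π y)) (hy'π.trans (hP _).1.symm) (hy'.trans (hP _).2.symm)]
  rw [hx'] at j1
  rw [hy'] at j3
  have l1 := Real.log_le_log (hh x) hxm
  have l3 := Real.log_le_log (hh y) hym
  have l2 : 0 ≤ 2 / m * (a - 0) := mul_nonneg (by positivity) (by linarith)
  have hb : a / m ≤ 1 + Δ / H := by
    have hΔ0 : 0 ≤ Δ := ha0.trans (hΔ _ _)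
    rcases le_total a H with haH | haH
    · have : a ≤ m := by rw [hm, min_eq_left haH]; exact le_max_right _ _
      have h1 : a / m ≤ 1 := (div_le_one hm0).2 this
      have : 0 ≤ Δ / H := by positivity
      linarith
    · have : H ≤ m := by rw [hm, min_eq_right haH]; exact le_max_right _ _
      have : a / m ≤ Δ / H := div_le_div₀ hΔ0 (hΔ _ _) hH this
      linarith
  refine ⟨_, ?_, (j1.trans hg (by linarith) l2 j2).trans hg (by linarith) (by linarith) j3, ?_⟩
  · linarith
  · have hme : m ≤ coneGauge dH π h x y := by
      have hx := hh x
      have := le_max_left (h x) (h y)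
      refine max_le (le_add_of_nonneg_left ha0) ((min_le_left _ _).trans ?_)
      exact le_add_of_nonneg_right (hx.le.trans this)
    have := Real.log_le_log hm0 hme
    rw [coneDist_eq hZ hh]
    have h5 : 2 / m * (a - 0) = 2 * (a / m) := by ring
    linarith

end Cone

/-! ### Attaching segments to a geodesic space -/

section Whisker

variable {X Y : Type*} {I : X → X → ℝ} {b : Y → X} {w : Y → ℝ}

open Classical in
/-- The length metric on the space obtained from `X` by attaching segments: the point `y` lies on
the segment attached at `b y`, at distance `w y` from `b y`. -/
def whiskerDist (I : X → X → ℝ) (b : Y → X) (w : Y → ℝ) (x y : Y) : ℝ :=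
  if b x = b y then |w x - w y| else w x + I (b x) (b y) + w y

theorem whiskerDist_le (hI : IsMetric I) (hw : ∀ y, 0 ≤ w y) (x y : Y) :
    whiskerDist I b w x y ≤ w x + I (b x) (b y) + w y := by
  have := hI.nonneg (b x) (b y)
  have := hw x
  have := hw y
  unfold whiskerDist
  split_ifs
  · rw [abs_le]
    constructor <;> linarith
  · rfl

theorem le_whiskerDist (hI : IsMetric I) (hw : ∀ y, 0 ≤ w y) (x y : Y) :
    |w x - w y| + I (b x) (b y) ≤ whiskerDist I b w x y := by
  unfold whiskerDist
  split_ifs with h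
  · rw [h, hI.self_eq_zero, add_zero]
  · have h1 : |w x - w y| ≤ w x + w y := by
      have := hw x
      have := hw y
      rw [abs_le]
      constructor <;> linarith
    linarith

theorem isMetric_whiskerDist (hI : IsMetric I) (hw : ∀ y, 0 ≤ w y)
    (hinj : ∀ x y, b x = b y → w x = w y → x = y) : IsMetric (whiskerDist I b w) where
  self_eq_zero x := by simp [whiskerDist]
  eq_of_eq_zero x y h := by
    have h1 := le_whiskerDist (b := b) hI hw x y
    have h2 := hI.nonneg (b x) (b y)
    have h3 := abs_nonneg (w x - w y)
    exact hinj x y (hI.eq_of_eq_zero _ _ (by linarith))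
      (sub_eq_zero.1 (abs_eq_zero.1 (by linarith)))
  symm x y := by
    unfold whiskerDist
    by_cases h : b x = b y
    · rw [if_pos h, if_pos h.symm, abs_sub_comm]
    · rw [if_neg h, if_neg (Ne.symm h), hI.symm]
      ring
  triangle x y z := by
    have e1 := le_whiskerDist (b := b) hI hw x y
    have e2 := le_whiskerDist (b := b) hI hw y z
    have t := hI.triangle (b x) (b y) (b z)
    have n1 := hI.nonneg (b x) (b y)
    have n2 := hI.nonneg (b y) (b z)
    have a1 := abs_sub_le (w x) (w y) (w z)
    have a2 := le_abs_self (w x - w y)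
    have a3 := neg_abs_le (w y - w z)
    by_cases hxz : b x = b z
    · rw [show whiskerDist I b w x z = |w x - w z| from if_pos hxz]
      linarith
    · rw [show whiskerDist I b w x z = _ from if_neg hxz]
      by_cases hxy : b x = b y
      · have hyz : b y ≠ b z := hxy ▸ hxz
        rw [show whiskerDist I b w y z = _ from if_neg hyz, hxy]
        linarith
      · rw [show whiskerDist I b w x y = _ from if_neg hxy]
        have := hw y
        linarith

/-- Over different base points the shortest curve runs down one segment, along a geodesic of the
base, and up the other segment; the pieces have lengths `w x`, `I (b x) (b y)` and `w y`. -/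
theorem lipJoined_whiskerDist (hI : IsMetric I) (hw : ∀ y, 0 ≤ w y)
    (hinj : ∀ x y, b x = b y → w x = w y → x = y) (hb : ∀ p, ∃ y, b y = p ∧ w y = 0)
    (hseg : ∀ y, ∀ s ∈ Set.Icc 0 (w y), ∃ z, b z = b y ∧ w z = s)
    (hJ : ∀ p q, LipJoined I p q (I p q)) (x y : Y) :
    LipJoined (whiskerDist I b w) x y (whiskerDist I b w x y) := by
  have hd := isMetric_whiskerDist hI hw hinj
  have seg : ∀ x y, b x = b y → w x ≤ w y → LipJoined (whiskerDist I b w) x y (w y - w x) := by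
    intro x y hxy hle
    have : Nonempty Y := ⟨x⟩
    choose! P hP using hseg y
    have key := lipJoined_of_Icc (ρ := whiskerDist I b w) (γ := P) (K := 1) hle one_pos
      (fun s hs t ht => by
        have h1 := hP s ⟨(hw x).trans hs.1, hs.2⟩
        have h2 := hP t ⟨(hw x).trans ht.1, ht.2⟩
        rw [whiskerDist, if_pos (h1.1.trans h2.1.symm), h1.2, h2.2, one_mul])
    have h1 := hP (w x) ⟨hw x, hle⟩
    have h2 := hP (w y) ⟨hw y, le_rfl⟩
    rwa [hinj _ x (h1.1.trans hxy.symm) h1.2, hinj _ y h2.1 h2.2, one_mul] at key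
  by_cases hxy : b x = b y
  · rw [show whiskerDist I b w x y = |w x - w y| from if_pos hxy]
    rcases le_total (w x) (w y) with hle | hle
    · rw [abs_of_nonpos (by linarith), neg_sub]
      exact seg x y hxy hle
    · rw [abs_of_nonneg (by linarith)]
      exact (seg y x hxy.symm hle).symm
  · rw [show whiskerDist I b w x y = _ from if_neg hxy]
    choose i hi using hb
    have j2 : LipJoined (whiskerDist I b w) (i (b x)) (i (b y)) (I (b x) (b y)) := by
      obtain ⟨γ, hγ, h0, h1⟩ := hJ (b x) (b y)
      refine ⟨fun s => i (γ s), fun s t => (whiskerDist_le hI hw _ _).trans ?_, congrArg i h0,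
        congrArg i h1⟩
      rw [(hi _).1, (hi _).1, (hi _).2, (hi _).2, zero_add, add_zero]
      exact hγ s t
    have j1 := (seg (i (b x)) x (hi _).1 ((hi _).2.trans_le (hw x))).symm
    have j3 := seg (i (b y)) y (hi _).1 ((hi _).2.trans_le (hw y))
    rw [(hi _).2, sub_zero] at j1 j3
    exact (j1.trans hd (hw _) (hI.nonneg _ _) j2).trans hd
      (add_nonneg (hw _) (hI.nonneg _ _)) (hw _) j3

end Whisker

/-- A metric at bounded distance from a function that satisfies the four-point condition is
hyperbolic. -/
theorem isGromovHyperbolic_of_abs_sub_le {Y : Type*} {d g : Y → Y → ℝ} {C δ : ℝ}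
    (hg : ∀ x y z t, g x y + g z t ≤ max (g x z + g y t) (g x t + g y z) + 2 * δ)
    (hδ : 0 ≤ δ) (hC : ∀ x y, |d x y - g x y| ≤ C) : IsGromovHyperbolic d := by
  by_cases hY : Nonempty Y
  · obtain ⟨y⟩ := hY
    have hC0 : 0 ≤ C := (abs_nonneg _).trans (hC y y)
    -- Two distances are replaced on each side of the inequality, an error of `4 * C` in all, which
    -- is twice `2 * C`.
    refine ⟨δ + 2 * C, by linarith, fun x y z t => ?_⟩
    have h := hg x y z t
    have e := fun x y => abs_le.1 (hC x y)
    have hm : max (g x z + g y t) (g x t + g y z) ≤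
        max (d x z + d y t) (d x t + d y z) + 2 * C := by
      refine max_le ?_ ?_
      · have := le_max_left (d x z + d y t) (d x t + d y z)
        linarith [(e x z).1, (e y t).1]
      · have := le_max_right (d x z + d y t) (d x t + d y z)
        linarith [(e x t).1, (e y z).1]
    linarith [(e x y).2, (e z t).2]
  · exact ⟨0, le_rfl, fun x => (hY ⟨x⟩).elim⟩

/-! ### Inner balls and nearest boundary points -/

section Domain

variable {N : ℕ} {D : Set (EuclideanSpace ℝ (Fin N))}

theorem notMem_of_mem_frontier (hD : IsOpen D) {p : EuclideanSpace ℝ (Fin N)}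
    (hp : p ∈ frontier D) : p ∉ D := fun h => (hD.frontier_eq ▸ hp).2 h

theorem IsLocalDefiningFunction.eq_zero (hD : IsOpen D) {p q : EuclideanSpace ℝ (Fin N)}
    {U : Set (EuclideanSpace ℝ (Fin N))} {ρ : EuclideanSpace ℝ (Fin N) → ℝ}
    (h : IsLocalDefiningFunction D p U ρ) (hq : q ∈ frontier D) (hqU : q ∈ U) : ρ q = 0 := by
  refine le_antisymm ?_ ?_
  · have hc : ContinuousAt ρ q := h.contDiffOn.continuousOn.continuousAt (h.isOpen.mem_nhds hqU)
    have hfr : ∃ᶠ y in 𝓝 q, y ∈ D := mem_closure_iff_frequently.1 (frontier_subset_closure hq)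
    refine le_of_tendsto_of_frequently hc.tendsto
      ((hfr.and_eventually (h.isOpen.mem_nhds hqU)).mono fun y hy => ?_)
    have : y ∈ D ∩ U := hy
    rw [h.inter_eq] at this
    exact this.2.le
  · by_contra! hneg
    have : q ∈ D ∩ U := by
      rw [h.inter_eq]
      exact ⟨hqU, hneg⟩
    exact notMem_of_mem_frontier hD hq this.1

theorem IsLocalDefiningFunction.hasDerivAt {p : EuclideanSpace ℝ (Fin N)}
    {U : Set (EuclideanSpace ℝ (Fin N))} {ρ : EuclideanSpace ℝ (Fin N) → ℝ}
    (h : IsLocalDefiningFunction D p U ρ) (v : EuclideanSpace ℝ (Fin N)) :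
    HasDerivAt (fun t : ℝ => ρ (p + t • v)) (inner ℝ (gradient ρ p) v) 0 := by
  have h1 : DifferentiableAt ℝ ρ p :=
    (h.contDiffOn.contDiffAt (h.isOpen.mem_nhds h.mem)).differentiableAt (by norm_num)
  have h2 := h1.hasGradientAt.hasFDerivAt
  have h3 : HasDerivAt (fun t : ℝ => p + t • v) v 0 := by
    simpa using ((hasDerivAt_id (0 : ℝ)).smul_const v).const_add p
  have h4 : HasFDerivAt ρ (InnerProductSpace.toDual ℝ _ (gradient ρ p)) (p + (0 : ℝ) • v) := by
    simpa using h2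
  exact h4.comp_hasDerivAt (0 : ℝ) h3

theorem IsOuterNormal.norm_eq_one {p n : EuclideanSpace ℝ (Fin N)} (h : IsOuterNormal D p n) :
    ‖n‖ = 1 := by
  obtain ⟨U, ρ, hρ, rfl⟩ := h
  rw [norm_smul, norm_inv, norm_norm, inv_mul_cancel₀ (norm_ne_zero_iff.2 hρ.gradient_ne_zero)]

/-- First-order expansion: a defining function vanishes at `p` and its slope along `v` is a positive
multiple of `inner ℝ n v`. Every use of the outer normal's direction in the next lemmas goes through
this test. -/
theorem IsOuterNormal.eventually_mem_iff (hD : IsOpen D) {p n v : EuclideanSpace ℝ (Fin N)}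
    (hp : p ∈ frontier D) (h : IsOuterNormal D p n) (hv : inner ℝ n v ≠ 0) :
    ∀ᶠ t in 𝓝[>] (0 : ℝ), p + t • v ∈ D ↔ inner ℝ n v < 0 := by
  obtain ⟨U, ρ, hρ, rfl⟩ := h
  have hpos : 0 < ‖gradient ρ p‖⁻¹ := inv_pos.2 (norm_pos_iff.2 hρ.gradient_ne_zero)
  rw [real_inner_smul_left] at hv ⊢
  have hU : ∀ᶠ t in 𝓝[>] (0 : ℝ), p + t • v ∈ U := by
    have : ContinuousAt (fun t : ℝ => p + t • v) 0 := by fun_prop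
    exact (this.eventually_mem (hρ.isOpen.mem_nhds (by simpa using hρ.mem))).filter_mono
      nhdsWithin_le_nhds
  have hslope := (hasDerivAt_iff_tendsto_slope.1 (hρ.hasDerivAt v)).mono_left
    (nhdsWithin_mono (0 : ℝ) fun t (ht : 0 < t) => ht.ne')
  have h0 := hρ.eq_zero hD hp hρ.mem
  simp only [slope_fun_def, sub_zero, zero_smul, add_zero, h0, vsub_eq_sub, smul_eq_mul] at hslope
  rcases lt_or_gt_of_ne (right_ne_zero_of_mul hv) with hlt | hgt
  · filter_upwards [hU, hslope.eventually_lt_const hlt, self_mem_nhdsWithin] with t htU ht ht0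
    have ht0 : 0 < t := ht0
    have : p + t • v ∈ D ∩ U := by
      rw [hρ.inter_eq]
      exact ⟨htU, by_contra fun hn => absurd ht
        (not_lt.2 (mul_nonneg (inv_nonneg.2 ht0.le) (not_lt.1 hn)))⟩
    exact iff_of_true this.1 (mul_neg_of_pos_of_neg hpos hlt)
  · filter_upwards [hU, hslope.eventually_const_lt hgt, self_mem_nhdsWithin] with t htU ht ht0
    have ht0 : 0 < t := ht0
    refine iff_of_false (fun hm => ?_) (not_lt.2 (mul_pos hpos hgt).le)
    have : p + t • v ∈ D ∩ U := ⟨hm, htU⟩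
    rw [hρ.inter_eq] at this
    exact absurd ht (not_lt.2 (mul_nonpos_of_nonneg_of_nonpos (inv_nonneg.2 ht0.le) this.2.le))

theorem IsOuterNormal.unique (hD : IsOpen D) {p n n' : EuclideanSpace ℝ (Fin N)}
    (hp : p ∈ frontier D) (h : IsOuterNormal D p n) (h' : IsOuterNormal D p n') : n = n' := by
  by_contra hne
  have e1 := h.norm_eq_one
  have e2 := h'.norm_eq_one
  have hlt : inner ℝ n n' < 1 := by
    have := inner_lt_one_iff_real_of_norm_eq_one e1 e2
    exact this.2 hne
  -- For distinct unit normals the direction `n' - n` would point into `D` according to `n` and out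
  -- of it according to `n'`.
  have i1 : inner ℝ n (n' - n) < 0 := by
    rw [inner_sub_right, real_inner_self_eq_norm_sq, e1]
    linarith
  have i2 : 0 < inner ℝ n' (n' - n) := by
    rw [inner_sub_right, real_inner_self_eq_norm_sq, e2, real_inner_comm]
    linarith
  obtain ⟨t, ht1, ht2⟩ := ((h.eventually_mem_iff hD hp i1.ne).and
    (h'.eventually_mem_iff hD hp i2.ne')).exists
  exact absurd (ht2.1 (ht1.2 i1)) (not_lt.2 i2.le)

/-- The ball is connected and misses the boundary, so it cannot meet both `D` and the exterior. -/
theorem ball_infDist_frontier_subset (hD : IsOpen D) {x : EuclideanSpace ℝ (Fin N)} (hx : x ∈ D) :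
    Metric.ball x (Metric.infDist x (frontier D)) ⊆ D := by
  by_cases hr : 0 < Metric.infDist x (frontier D)
  · refine (convex_ball _ _).isPreconnected.subset_left_of_subset_union hD
      (isClosed_closure (s := D)).isOpen_compl ?_ (fun y hy => ?_) ⟨x, Metric.mem_ball_self hr, hx⟩
    · exact Set.disjoint_left.2 fun y hy hy' => hy' (subset_closure hy)
    · by_contra hn
      simp only [Set.mem_union, Set.mem_compl_iff, not_or, not_not] at hn
      exact Set.disjoint_left.1 Metric.disjoint_ball_infDist hy
        (hD.frontier_eq ▸ ⟨hn.2, hn.1⟩)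
  · rw [Metric.ball_eq_empty.2 (not_lt.1 hr)]
    exact Set.empty_subset _

/-- An inner ball touching the boundary at `p` is centred on the inner normal at `p`. -/
theorem IsOuterNormal.center_eq (hD : IsOpen D) {p n x : EuclideanSpace ℝ (Fin N)}
    (hp : p ∈ frontier D) (h : IsOuterNormal D p n) (hball : Metric.ball x (dist x p) ⊆ D)
    (hxp : x ≠ p) : x = p - dist x p • n := by
  set t := dist x p with ht
  have ht0 : 0 < t := dist_pos.2 hxp
  have htn : ‖x - p‖ = t := (dist_eq_norm x p).symm
  set u := t⁻¹ • (x - p) with hu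
  have hun : ‖u‖ = 1 := by
    rw [hu, norm_smul, htn, norm_inv, Real.norm_of_nonneg ht0.le, inv_mul_cancel₀ ht0.ne']
  have hxu : x - p = t • u := by rw [hu, smul_smul, mul_inv_cancel₀ ht0.ne', one_smul]
  by_cases hne : -u = n
  · rw [← hne, smul_neg, sub_neg_eq_add, ← hxu]
    abel
  exfalso
  have e1 := h.norm_eq_one
  have hlt : inner ℝ (-u) n < 1 :=
    (inner_lt_one_iff_real_of_norm_eq_one (by rwa [norm_neg]) e1).2 hne
  rw [inner_neg_left] at hlt
  -- If the direction `u` to the centre is not `-n`, then `u + n` makes an acute angle with both `u`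
  -- and `n`: small steps along it enter the ball yet leave `D`.
  set c := inner ℝ u n with hc
  have i1 : inner ℝ n (u + n) = 1 + c := by
    rw [inner_add_right, real_inner_self_eq_norm_sq, e1, real_inner_comm]
    ring
  have i2 : inner ℝ u (u + n) = 1 + c := by
    rw [inner_add_right, real_inner_self_eq_norm_sq, hun]
    ring
  have hev : ∀ᶠ s in 𝓝[>] (0 : ℝ), s * ‖u + n‖ ^ 2 < 2 * t * (1 + c) := by
    have : Tendsto (fun s : ℝ => s * ‖u + n‖ ^ 2) (𝓝[>] 0) (𝓝 0) := by
      have : ContinuousAt (fun s : ℝ => s * ‖u + n‖ ^ 2) 0 := by fun_prop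
      simpa using this.tendsto.mono_left nhdsWithin_le_nhds
    exact this.eventually_lt_const (mul_pos (by linarith) (by linarith))
  obtain ⟨s, hs1, hs2, hs0⟩ := ((h.eventually_mem_iff (v := u + n) hD hp
    (by rw [i1]; linarith)).and (hev.and self_mem_nhdsWithin)).exists
  have hs0 : 0 < s := hs0
  refine absurd (hs1.1 (hball ?_)) (not_lt.2 (by rw [i1]; linarith))
  rw [Metric.mem_ball, dist_eq_norm, show p + s • (u + n) - x = s • (u + n) - t • u by
    rw [← hxu]; abel]
  refine lt_of_pow_lt_pow_left₀ 2 ht0.le ?_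
  rw [norm_sub_sq_real, norm_smul, norm_smul, hun, real_inner_smul_left, real_inner_smul_right,
    real_inner_comm, i2, Real.norm_of_nonneg hs0.le, Real.norm_of_nonneg ht0.le]
  nlinarith

/-- A smaller closed ball internally tangent at `p` meets the larger sphere only at `p`. In terms of
`u = y - p`, the smaller ball is `‖u‖² + 2s⟨u,n⟩ ≤ 0`, which for `u ≠ 0` becomes strict when `s`
increases to `τ`. -/
theorem closedBall_subset_insert_of_ball_subset {p n : EuclideanSpace ℝ (Fin N)} (hn : ‖n‖ = 1)
    {s τ : ℝ} (hs : 0 < s) (hsτ : s < τ) (hball : Metric.ball (p - τ • n) τ ⊆ D) :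
    Metric.closedBall (p - s • n) s ⊆ insert p D := by
  intro y hy
  by_cases hyp : y = p
  · exact Or.inl hyp
  refine Or.inr (hball ?_)
  set u := y - p with hu
  have hu0 : 0 < ‖u‖ := norm_pos_iff.2 (sub_ne_zero.2 hyp)
  have key : ∀ r : ℝ, ‖y - (p - r • n)‖ ^ 2 = ‖u‖ ^ 2 + 2 * r * inner ℝ u n + r ^ 2 := fun r => by
    rw [show y - (p - r • n) = u + r • n by rw [hu]; abel, norm_add_sq_real, norm_smul, hn,
      real_inner_smul_right, mul_one, Real.norm_eq_abs, sq_abs]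
    ring
  rw [Metric.mem_closedBall, dist_eq_norm] at hy
  rw [Metric.mem_ball, dist_eq_norm]
  have h1 := pow_le_pow_left₀ (norm_nonneg _) hy 2
  rw [key] at h1
  refine lt_of_pow_lt_pow_left₀ 2 (hs.trans hsτ).le ?_
  rw [key]
  have h2 : 0 < ‖u‖ ^ 2 := by positivity
  nlinarith

theorem closedBall_subset_insert_of_le {p n : EuclideanSpace ℝ (Fin N)} (hn : ‖n‖ = 1)
    {s τ : ℝ} (hsτ : s ≤ τ) (hball : Metric.closedBall (p - τ • n) τ ⊆ insert p D) :
    Metric.closedBall (p - s • n) s ⊆ insert p D := by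
  refine (Metric.closedBall_subset_closedBall' ?_).trans hball
  rw [dist_eq_norm, show p - s • n - (p - τ • n) = (τ - s) • n by rw [sub_smul]; abel, norm_smul,
    hn, Real.norm_of_nonneg (by linarith)]
  linarith

/-- The centre of an inner ball meeting the complement only at `p` has `p` as its unique nearest
boundary point. -/
theorem infDist_of_closedBall_subset (hD : IsOpen D) {p n : EuclideanSpace ℝ (Fin N)}
    (hp : p ∈ frontier D) (hn : ‖n‖ = 1) {s : ℝ} (hs : 0 < s)
    (hball : Metric.closedBall (p - s • n) s ⊆ insert p D) :
    p - s • n ∈ D ∧ Metric.infDist (p - s • n) (frontier D) = s ∧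
      ∀ q ∈ frontier D, dist (p - s • n) q = s → q = p := by
  have hq : ∀ q ∈ frontier D, dist (p - s • n) q ≤ s → q = p := fun q hq h =>
    (hball (by rwa [Metric.mem_closedBall, dist_comm])).resolve_right (notMem_of_mem_frontier hD hq)
  have hdp : dist (p - s • n) p = s := by
    rw [dist_eq_norm, sub_sub_cancel_left, norm_neg, norm_smul, hn, Real.norm_of_nonneg hs.le,
      mul_one]
  refine ⟨(hball (Metric.mem_closedBall_self hs.le)).resolve_left fun h => ?_, ?_,
    fun q h h' => hq q h h'.le⟩
  · rw [h, dist_self] at hdp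
    exact hs.ne hdp
  · refine le_antisymm ((Metric.infDist_le_dist_of_mem hp).trans hdp.le) ?_
    refine (Metric.le_infDist ⟨p, hp⟩).2 fun q hqD => ?_
    by_contra! hlt
    rw [hq q hqD hlt.le, hdp] at hlt
    exact lt_irrefl _ hlt

theorem isCompact_frontier_of_isBounded (hb : Bornology.IsBounded D) : IsCompact (frontier D) :=
  Metric.isCompact_of_isClosed_isBounded isClosed_frontier
    (hb.closure.subset frontier_subset_closure)

theorem infDist_frontier_pos (hD : IsOpen D) {x : EuclideanSpace ℝ (Fin N)} (hx : x ∈ D)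
    (hne : (frontier D).Nonempty) : 0 < Metric.infDist x (frontier D) :=
  (isClosed_frontier.notMem_iff_infDist_pos hne).1 fun h => notMem_of_mem_frontier hD h hx

end Domain

/-! ### Normal coordinates: projection and depth -/

namespace ConstructionData

variable {N : ℕ} {D : Set (EuclideanSpace ℝ (Fin N))} (c : ConstructionData D)

theorem norm_normal (p : frontier D) : ‖c.normal p‖ = 1 := (c.isOuterNormal p).norm_eq_one

/-- The distance to the boundary. -/
def depth (_c : ConstructionData D) (x : D) : ℝ :=
  Metric.infDist (x : EuclideanSpace ℝ (Fin N)) (frontier D)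

theorem depth_pos (hD : IsOpen D) (x : D) : 0 < c.depth x :=
  infDist_frontier_pos hD x.2 ⟨_, (c.proj x).2⟩

theorem height_pos (hD : IsOpen D) (x : D) : 0 < c.height x := Real.sqrt_pos.2 (c.depth_pos hD x)

theorem height_sq (x : D) : c.height x ^ 2 = c.depth x := Real.sq_sqrt Metric.infDist_nonneg

theorem mem_collar {x : D} : x ∈ c.collar ↔ c.depth x ≤ c.ε := by
  rw [← height_sq]
  rfl

/-- The ball about `x` of radius its depth is an inner ball touching the boundary at `proj x`. This
holds also outside the collar, so projection and depth always determine the point. -/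
theorem coe_eq (hD : IsOpen D) (x : D) : (x : EuclideanSpace ℝ (Fin N)) =
    (c.proj x : EuclideanSpace ℝ (Fin N)) - c.depth x • c.normal (c.proj x) := by
  have h := (c.isOuterNormal (c.proj x)).center_eq (x := x) hD (c.proj x).2
    (by rw [c.dist_proj]; exact ball_infDist_frontier_subset hD x.2)
    (fun h => notMem_of_mem_frontier hD (c.proj x).2 (h ▸ x.2))
  rwa [c.dist_proj] at h

/-- The ball touches the boundary at `p` alone, so every nearest-point selection takes the value `p`
at its centre. -/
theorem exists_of_closedBall (hD : IsOpen D) {p : frontier D} {s : ℝ} (hs : 0 < s)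
    (hball : Metric.closedBall ((p : EuclideanSpace ℝ (Fin N)) - s • c.normal p) s ⊆ insert ↑p D) :
    ∃ y : D, (y : EuclideanSpace ℝ (Fin N)) = p - s • c.normal p ∧ c.depth y = s ∧
      c.proj y = p := by
  obtain ⟨h1, h2, h3⟩ := infDist_of_closedBall_subset hD p.2 (c.norm_normal p) hs hball
  refine ⟨⟨_, h1⟩, rfl, h2, Subtype.ext (h3 _ (c.proj _).2 ?_)⟩
  exact (c.dist_proj ⟨_, h1⟩).trans h2

/-- The collar is parametrized by the boundary and the depth. -/
theorem exists_collar_point (hD : IsOpen D) (p : frontier D) {s : ℝ} (hs : 0 < s) (hsε : s ≤ c.ε) :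
    ∃ y : D, (y : EuclideanSpace ℝ (Fin N)) = p - s • c.normal p ∧ c.depth y = s ∧ c.proj y = p :=
  c.exists_of_closedBall hD hs
    (closedBall_subset_insert_of_le (c.norm_normal p) hsε (c.interior_ball p))

theorem exists_segment_point (hD : IsOpen D) (x : D) {s : ℝ} (hs : 0 < s) (hsx : s ≤ c.depth x) :
    ∃ y : D, c.depth y = s ∧ c.proj y = c.proj x := by
  -- At full depth, `x` may have several nearest points, so `x` itself is taken; strictly closer to
  -- the boundary the tangent ball shrinks and the nearest point is unique.
  rcases hsx.eq_or_lt with rfl | hlt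
  · exact ⟨x, rfl, rfl⟩
  obtain ⟨y, -, h⟩ := c.exists_of_closedBall hD hs
    (closedBall_subset_insert_of_ball_subset (c.norm_normal _) hs hlt
      (by rw [← c.coe_eq hD]; exact ball_infDist_frontier_subset hD x.2))
  exact ⟨y, h⟩

theorem eq_of_proj_eq (hD : IsOpen D) {x y : D} (h : c.proj x = c.proj y)
    (h' : c.depth x = c.depth y) : x = y :=
  Subtype.ext (by rw [c.coe_eq hD x, c.coe_eq hD y, h, h'])

theorem foot_spec (hD : IsOpen D) (x : D) :
    c.depth (c.foot x) = c.ε ∧ c.proj (c.foot x) = c.proj x := by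
  obtain ⟨y, h1, h2⟩ := c.exists_collar_point hD (c.proj x) c.ε_pos le_rfl
  rwa [show c.foot x = y from Subtype.ext h1.symm]

theorem dist_of_proj_eq (hD : IsOpen D) {x y : D} (h : c.proj x = c.proj y) :
    dist x y = |c.depth x - c.depth y| := by
  rw [Subtype.dist_eq, c.coe_eq hD x, c.coe_eq hD y, h, dist_eq_norm, sub_sub_sub_cancel_left,
    ← sub_smul, norm_smul, c.norm_normal, mul_one, Real.norm_eq_abs, abs_sub_comm]

end ConstructionData

/-! ### Metrics inducing the topology -/

section InducesTopology

variable {X : Type*} [TopologicalSpace X] {d : X → X → ℝ}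

theorem InducesTopology.tendsto_iff (ht : InducesTopology d) (hd : IsMetric d) {ι : Type*}
    {l : Filter ι} {u : ι → X} {p : X} :
    Tendsto u l (𝓝 p) ↔ Tendsto (fun i => d p (u i)) l (𝓝 0) := by
  constructor
  · intro h
    refine tendsto_order.2 ⟨fun a ha => Eventually.of_forall fun i => ha.trans_le (hd.nonneg _ _),
      fun r hr => ?_⟩
    refine h.eventually_mem (IsOpen.mem_nhds (s := {q | d p q < r}) ((ht _).2 fun q hq => ?_) ?_)
    · refine ⟨r - d p q, sub_pos.2 hq, fun q' hq' => ?_⟩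
      have := hd.triangle p q q'
      change d p q' < r
      linarith
    · change d p p < r
      rwa [hd.self_eq_zero]
  · intro h
    refine tendsto_nhds.2 fun s hs hps => ?_
    obtain ⟨r, hr, hrs⟩ := (ht s).1 hs p hps
    filter_upwards [h.eventually_lt_const hr] with i hi using hrs _ hi

theorem InducesTopology.continuous (ht : InducesTopology d) (hd : IsMetric d) :
    Continuous fun p : X × X => d p.1 p.2 := by
  refine continuous_iff_continuousAt.2 fun p => ?_
  have h1 := (ht.tendsto_iff hd).1 (continuous_fst.tendsto p)
  have h2 := (ht.tendsto_iff hd).1 (continuous_snd.tendsto p)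
  refine tendsto_iff_dist_tendsto_zero.2 (squeeze_zero (fun _ => dist_nonneg) (fun q => ?_)
    (by simpa using h1.add h2))
  rw [Real.dist_eq, abs_le]
  have e1 := hd.triangle q.1 p.1 q.2
  have e2 := hd.triangle p.1 p.2 q.2
  have e3 := hd.triangle p.1 q.1 p.2
  have e4 := hd.triangle q.1 q.2 p.2
  rw [hd.symm q.1 p.1] at e1
  rw [hd.symm q.2 p.2] at e4
  constructor <;> linarith

end InducesTopology

/-! ### The collar as a hyperbolic cone -/

namespace ConstructionData

variable {N : ℕ} {D : Set (EuclideanSpace ℝ (Fin N))} (c : ConstructionData D)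

/-- The function `g`, restricted to the collar. -/
abbrev collarG : c.collar → c.collar → ℝ :=
  coneDist c.dH (fun x => c.proj x) (fun x => c.height x)

theorem collar_injective (hD : IsOpen D) (x y : c.collar) (h : c.proj x = c.proj y)
    (h' : c.height x = c.height y) : x = y :=
  Subtype.ext (c.eq_of_proj_eq hD h (by rw [← height_sq, ← height_sq, h']))

theorem isMetric_collarG (hD : IsOpen D) : IsMetric c.collarG :=
  isMetric_coneDist c.dH_isMetric (fun x => c.height_pos hD x) (c.collar_injective hD)

theorem height_le (x : c.collar) : c.height x ≤ √c.ε := Real.le_sqrt_of_sq_le x.2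

theorem collar_surjective (hD : IsOpen D) (p : frontier D) (k : ℝ) (hk : 0 < k) (hkε : k ≤ √c.ε) :
    ∃ x : c.collar, c.proj x = p ∧ c.height x = k := by
  have hk2 : k ^ 2 ≤ c.ε := (Real.le_sqrt hk.le c.ε_pos.le).1 hkε
  obtain ⟨y, -, h1, h2⟩ := c.exists_collar_point hD p (pow_pos hk 2) hk2
  exact ⟨⟨y, c.mem_collar.2 (h1.trans_le hk2)⟩, h2,
    (congrArg Real.sqrt h1).trans (Real.sqrt_sq hk.le)⟩

theorem exists_dH_le (hb : Bornology.IsBounded D) : ∃ Δ, ∀ p q, c.dH p q ≤ Δ := by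
  have : CompactSpace (frontier D) :=
    isCompact_iff_compactSpace.1 (isCompact_frontier_of_isBounded hb)
  obtain ⟨Δ, hΔ⟩ := (isCompact_range (c.dH_topology.continuous c.dH_isMetric)).bddAbove
  exact ⟨Δ, fun p q => hΔ ⟨(p, q), rfl⟩⟩

theorem continuous_depth : Continuous c.depth :=
  (Metric.continuous_infDist_pt _).comp continuous_subtype_val

theorem continuous_height : Continuous c.height := Real.continuous_sqrt.comp c.continuous_depth

theorem eq_proj (hD : IsOpen D) {x : D} (hx : x ∈ c.collar) {q : frontier D}
    (hq : dist (x : EuclideanSpace ℝ (Fin N)) q = c.depth x) : q = c.proj x := by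
  have h := (infDist_of_closedBall_subset hD (c.proj x).2 (c.norm_normal _) (c.depth_pos hD x)
    (closedBall_subset_insert_of_le (c.norm_normal _) (c.mem_collar.1 hx)
      (c.interior_ball _))).2.2
  rw [← c.coe_eq hD x] at h
  exact Subtype.ext (h q q.2 hq)

/-- As `y → x`, the point `proj y` nearly minimizes the distance from `x` to the boundary; the
boundary is compact and in the collar the minimizer is unique. -/
theorem continuous_proj (hD : IsOpen D) (hb : Bornology.IsBounded D) :
    Continuous fun x : c.collar => c.proj x := by
  have : CompactSpace (frontier D) :=
    isCompact_iff_compactSpace.1 (isCompact_frontier_of_isBounded hb)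
  refine continuous_iff_continuousAt.2 fun x => ?_
  refine tendsto_of_tendsto_comp (K := Set.univ) isCompact_univ
    (φ := fun q : frontier D => dist ((x : D) : EuclideanSpace ℝ (Fin N)) q) (by fun_prop)
    (by simp) ?_ fun q _ hq => c.eq_proj hD x.2 (hq.trans (c.dist_proj x))
  have h1 : Tendsto (fun y : c.collar => c.depth y) (𝓝 x) (𝓝 (c.depth x)) :=
    (c.continuous_depth.comp continuous_subtype_val).tendsto x
  have h2 : Tendsto (fun y : c.collar => dist x y) (𝓝 x) (𝓝 0) := by
    have : Continuous fun y : c.collar => dist x y := by fun_prop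
    simpa using this.tendsto x
  rw [c.dist_proj]
  change Tendsto _ _ (𝓝 (c.depth x))
  refine tendsto_of_tendsto_of_tendsto_of_le_of_le tendsto_const_nhds
    (by simpa using h1.add h2) (fun y => Metric.infDist_le_dist_of_mem (c.proj y).2) fun y => ?_
  have h3 := dist_triangle (((x : D) : EuclideanSpace ℝ (Fin N))) ((y : D))
    (c.proj y : EuclideanSpace ℝ (Fin N))
  rw [c.dist_proj] at h3
  change _ ≤ Metric.infDist _ _ + dist (((x : D) : EuclideanSpace ℝ (Fin N))) ((y : D))
  linarith

theorem continuous_collarG (hD : IsOpen D) (hb : Bornology.IsBounded D) :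
    Continuous fun p : c.collar × c.collar => c.collarG p.1 p.2 := by
  have h1 := c.continuous_proj hD hb
  have h2 : Continuous fun x : c.collar => c.height x :=
    c.continuous_height.comp continuous_subtype_val
  have h3 : Continuous fun p : c.collar × c.collar => c.dH (c.proj p.1) (c.proj p.2) :=
    (c.dH_topology.continuous c.dH_isMetric).comp
      ((h1.comp continuous_fst).prodMk (h1.comp continuous_snd))
  have h4 : Continuous fun p : c.collar × c.collar =>
      2 * Real.log (coneGauge c.dH (fun x : c.collar => c.proj x) (fun x => c.height x) p.1 p.2) -
        Real.log (c.height p.1) - Real.log (c.height p.2) := by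
    have e1 : Continuous fun p : c.collar × c.collar => c.height p.1 := h2.comp continuous_fst
    have e2 : Continuous fun p : c.collar × c.collar => c.height p.2 := h2.comp continuous_snd
    refine ((continuous_const.mul ((h3.add (e1.max e2)).log fun p => ?_)).sub
      (e1.log fun p => (c.height_pos hD _).ne')).sub (e2.log fun p => (c.height_pos hD _).ne')
    exact (coneGauge_pos (π := fun x : c.collar => c.proj x) c.dH_isMetric
      (fun x : c.collar => c.height_pos hD x) p.1 p.2).ne'
  exact h4.congr fun p => (coneDist_eq c.dH_isMetric (fun x => c.height_pos hD _) _ _).symm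

theorem isCompact_setOf_le_depth (hD : IsOpen D) (hb : Bornology.IsBounded D) {δ : ℝ}
    (hδ : 0 < δ) : IsCompact {y : c.collar | δ ≤ c.depth y} := by
  have hi : IsInducing fun y : c.collar => ((y : D) : EuclideanSpace ℝ (Fin N)) :=
    IsInducing.subtypeVal.comp IsInducing.subtypeVal
  rw [hi.isCompact_iff]
  have himg : (fun y : c.collar => ((y : D) : EuclideanSpace ℝ (Fin N))) ''
      {y : c.collar | δ ≤ c.depth y} = closure D ∩ (fun z => Metric.infDist z (frontier D)) ⁻¹'
        Set.Icc δ c.ε := by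
    ext z
    constructor
    · rintro ⟨y, hy, rfl⟩
      exact ⟨subset_closure (y : D).2, hy, c.mem_collar.1 y.2⟩
    · rintro ⟨hz, hz1, hz2⟩
      have hzD : z ∈ D := by
        by_contra hn
        have : z ∈ frontier D := hD.frontier_eq ▸ ⟨hz, hn⟩
        have h0 := Metric.infDist_zero_of_mem this
        linarith
      exact ⟨⟨⟨z, hzD⟩, c.mem_collar.2 hz2⟩, hz1, rfl⟩
  rw [himg]
  exact (Metric.isCompact_of_isClosed_isBounded isClosed_closure hb.closure).inter_right
    (isClosed_Icc.preimage (Metric.continuous_infDist_pt _))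

/-- A bound on `g` bounds the change of `log h`, so the ball stays at depth at least `(h(x)
e^{-R})²`, away from the boundary. -/
theorem isCompact_collar_ball (hD : IsOpen D) (hb : Bornology.IsBounded D) (x : c.collar) (R : ℝ) :
    IsCompact {y | c.collarG x y ≤ R} := by
  have hpos := c.height_pos hD x
  refine (c.isCompact_setOf_le_depth hD hb (δ := (c.height x * Real.exp (-R)) ^ 2)
    (by positivity)).of_isClosed_subset ?_ fun y hy => ?_
  · exact isClosed_le ((c.continuous_collarG hD hb).comp (continuous_const.prodMk continuous_id))
      continuous_const
  · change _ ≤ c.depth y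
    rw [← height_sq]
    refine pow_le_pow_left₀ (by positivity) ?_ 2
    have h1 := (abs_log_sub_log_le_coneDist (π := fun x : c.collar => c.proj x) c.dH_isMetric
      (fun x : c.collar => c.height_pos hD x) x y).trans hy
    have h2 := (le_abs_self _).trans h1
    rw [← Real.exp_log (c.height_pos hD x), ← Real.exp_add,
      ← Real.le_log_iff_exp_le (c.height_pos hD y)]
    linarith

theorem exists_lipJoined (hD : IsOpen D) (hb : Bornology.IsBounded D) :
    ∃ C, ∀ x y : c.collar, ∃ ℓ, 0 ≤ ℓ ∧ LipJoined c.collarG x y ℓ ∧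
      ℓ ≤ c.collarG x y + C := by
  obtain ⟨Δ, hΔ⟩ := c.exists_dH_le hb
  exact ⟨_, exists_lipJoined_coneDist c.dH_isMetric c.dH_geodesic hΔ (Real.sqrt_pos.2 c.ε_pos)
    (fun x => c.height_pos hD x) c.height_le (c.collar_injective hD) (c.collar_surjective hD)⟩

theorem lipJoined_collar (hD : IsOpen D) (hb : Bornology.IsBounded D) (x y : c.collar) :
    ∃ ℓ, 0 ≤ ℓ ∧ LipJoined c.collarG x y ℓ := by
  obtain ⟨C, hC⟩ := c.exists_lipJoined hD hb
  obtain ⟨ℓ, h0, h1, -⟩ := hC x y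
  exact ⟨ℓ, h0, h1⟩

/-- A shortest Lipschitz curve, rescaled to `[0, 1]`, is a continuous path since `g`-convergence
implies Euclidean convergence; conversely a path of finite length becomes a Lipschitz curve through
arc length. The comparison is made in `ℝ≥0∞`, where paths of infinite length do no harm. -/
theorem collarDist_eq (hD : IsOpen D) (hb : Bornology.IsBounded D) (x y : c.collar) :
    c.collarDist x y = intrinsicDist c.collarG x y := by
  have hg := c.isMetric_collarG hD
  have hc := c.continuous_collarG hD hb
  have hK := c.isCompact_collar_ball hD hb
  have key : (⨅ (γ : Path (x : D) (y : D)) (_ : ∀ t, γ t ∈ c.collar), pathLength c.g γ) =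
      ENNReal.ofReal (intrinsicDist c.collarG x y) := by
    refine le_antisymm ?_ (le_iInf fun γ => le_iInf fun hγ => ?_)
    · have hI := intrinsicDist_nonneg (ρ := c.collarG) x y
      obtain ⟨γ, hγ, h0, h1⟩ := lipJoined_intrinsicDist hg hc hK (c.lipJoined_collar hD hb x y)
      have hle : ∀ s t : unitInterval, c.collarG (γ (intrinsicDist c.collarG x y * s))
          (γ (intrinsicDist c.collarG x y * t)) ≤ intrinsicDist c.collarG x y * |(s : ℝ) - t| :=
        fun s t => (hγ _ _).trans (by rw [← mul_sub, abs_mul, abs_of_nonneg hI])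
      have hcont : Continuous fun t : unitInterval => γ (intrinsicDist c.collarG x y * t) := by
        refine continuous_iff_continuousAt.2 fun t => tendsto_of_dist_tendsto_zero hg hc hK ?_
        refine squeeze_zero (fun _ => hg.nonneg _ _) (hle t) ?_
        have : Continuous fun s : unitInterval =>
          intrinsicDist c.collarG x y * |(t : ℝ) - s| := by fun_prop
        simpa using this.tendsto t
      let P : Path (x : D) (y : D) :=
        { toFun := fun t => γ (intrinsicDist c.collarG x y * t)
          continuous_toFun := continuous_subtype_val.comp hcont
          source' := by simp [h0]
          target' := by simp [h1] }
      refine iInf₂_le_of_le P (fun t => Subtype.property _) (pathLength_le (fun s t hst => ?_) hI)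
      refine (hle s t).trans_eq ?_
      rw [abs_of_nonpos (sub_nonpos.2 (show (s : ℝ) ≤ t from hst)), neg_sub]
    · by_cases htop : pathLength c.g γ = ⊤
      · rw [htop]
        exact le_top
      · have hcont : Continuous fun t => (⟨γ t, hγ t⟩ : c.collar) :=
          γ.continuous.subtype_mk hγ
        have hj := lipJoined_of_pathLength (f := fun t => (⟨γ t, hγ t⟩ : c.collar)) hg
          (fun t => by
            have := (hc.comp (hcont.prodMk (continuous_const (y := (⟨γ t, hγ t⟩ : c.collar))))).tendsto t
            simpa only [Function.comp_def, hg.self_eq_zero] using this) htop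
        have e0 : (⟨γ 0, hγ 0⟩ : c.collar) = x := Subtype.ext γ.source
        have e1 : (⟨γ 1, hγ 1⟩ : c.collar) = y := Subtype.ext γ.target
        rw [e0, e1] at hj
        exact ENNReal.ofReal_le_of_le_toReal (intrinsicDist_le ENNReal.toReal_nonneg hj)
  rw [collarDist, key, ENNReal.toReal_ofReal (intrinsicDist_nonneg _ _)]

/-! ### The metric on the domain -/

open Classical in
/-- The retraction of the domain onto the collar along the normals. -/
def base (hD : IsOpen D) (x : D) : c.collar :=
  if h : x ∈ c.collar then ⟨x, h⟩ else ⟨c.foot x, c.mem_collar.2 (c.foot_spec hD x).1.le⟩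

/-- The distance to the collar. -/
def whiskerLength (x : D) : ℝ := max (c.depth x - c.ε) 0

theorem base_of_mem (hD : IsOpen D) {x : D} (h : x ∈ c.collar) : c.base hD x = ⟨x, h⟩ := dif_pos h

theorem coe_base_of_notMem (hD : IsOpen D) {x : D} (h : x ∉ c.collar) :
    (c.base hD x : D) = c.foot x := by rw [base, dif_neg h]

theorem whiskerLength_of_mem {x : D} (h : x ∈ c.collar) : c.whiskerLength x = 0 :=
  max_eq_right (sub_nonpos.2 (c.mem_collar.1 h))

theorem whiskerLength_of_notMem {x : D} (h : x ∉ c.collar) :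
    c.whiskerLength x = c.depth x - c.ε :=
  max_eq_left (sub_nonneg.2 (not_le.1 fun h' => h (c.mem_collar.2 h')).le)

theorem whiskerLength_nonneg (x : D) : 0 ≤ c.whiskerLength x := le_max_right _ _

theorem dist_foot (hD : IsOpen D) {x : D} (h : x ∉ c.collar) :
    dist x (c.foot x) = c.whiskerLength x := by
  rw [c.dist_of_proj_eq hD (c.foot_spec hD x).2.symm, (c.foot_spec hD x).1,
    c.whiskerLength_of_notMem h, ← c.whiskerLength_of_notMem h,
    abs_of_nonneg (c.whiskerLength_nonneg x)]

theorem proj_base (hD : IsOpen D) (x : D) : c.proj (c.base hD x) = c.proj x := by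
  by_cases h : x ∈ c.collar
  · rw [c.base_of_mem hD h]
  · rw [c.coe_base_of_notMem hD h, (c.foot_spec hD x).2]

theorem depth_base (hD : IsOpen D) (x : D) : c.depth (c.base hD x) = min (c.depth x) c.ε := by
  by_cases h : x ∈ c.collar
  · rw [c.base_of_mem hD h, min_eq_left (c.mem_collar.1 h)]
  · rw [c.coe_base_of_notMem hD h, (c.foot_spec hD x).1,
      min_eq_right (not_le.1 fun h' => h (c.mem_collar.2 h')).le]

theorem base_injective (hD : IsOpen D) (x y : D) (h : c.base hD x = c.base hD y)
    (h' : c.whiskerLength x = c.whiskerLength y) : x = y := by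
  refine c.eq_of_proj_eq hD (by rw [← c.proj_base hD x, h, c.proj_base]) ?_
  have e : ∀ x, c.depth x = c.depth (c.base hD x) + c.whiskerLength x := fun x => by
    rw [c.depth_base, whiskerLength]
    rcases le_total (c.depth x) c.ε with hx | hx
    · rw [min_eq_left hx, max_eq_right (by linarith), add_zero]
    · rw [min_eq_right hx, max_eq_left (by linarith)]
      ring
  rw [e x, e y, h, h']

/-- The four cases of `d` become one formula. Outside the collar, equal projections mean equal base
points; when at least one point lies in the collar, coinciding base points give `I = 0` and one
whisker length 0, so both branches of `whiskerDist` agree. -/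
theorem d_eq_whiskerDist (hD : IsOpen D) (hb : Bornology.IsBounded D) :
    c.d = whiskerDist (intrinsicDist c.collarG) (c.base hD) c.whiskerLength := by
  have hI := isMetric_intrinsicDist (c.isMetric_collarG hD) (c.lipJoined_collar hD hb)
  have hcd : ∀ x y : D, ∀ x' y' : c.collar, (x' : D) = x → (y' : D) = y →
      c.collarDist x y = intrinsicDist c.collarG x' y' := by
    rintro _ _ x' y' rfl rfl
    exact c.collarDist_eq hD hb x' y'
  funext x y
  by_cases hx : x ∈ c.collar <;> by_cases hy : y ∈ c.collar
  · rw [d, if_pos hx, if_pos hy, hcd x y _ _ (congrArg _ (c.base_of_mem hD hx))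
      (congrArg _ (c.base_of_mem hD hy)), whiskerDist, c.whiskerLength_of_mem hx,
      c.whiskerLength_of_mem hy]
    split_ifs with h
    · rw [h, hI.self_eq_zero]
      simp
    · ring
  · rw [d, if_pos hx, if_neg hy, hcd x _ _ _ (congrArg _ (c.base_of_mem hD hx))
      (c.coe_base_of_notMem hD hy), whiskerDist, c.whiskerLength_of_mem hx, c.dist_foot hD hy]
    split_ifs with h
    · rw [h, hI.self_eq_zero, zero_sub, abs_neg, abs_of_nonneg (c.whiskerLength_nonneg y), zero_add]
    · ring
  · rw [d, if_neg hx, if_pos hy, hcd y _ _ _ (congrArg _ (c.base_of_mem hD hy))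
      (c.coe_base_of_notMem hD hx), whiskerDist, c.whiskerLength_of_mem hy, c.dist_foot hD hx,
      hI.symm]
    split_ifs with h
    · rw [h, hI.self_eq_zero, sub_zero, abs_of_nonneg (c.whiskerLength_nonneg x), zero_add]
    · ring
  · rw [d, if_neg hx, if_neg hy, whiskerDist, c.dist_foot hD hx, c.dist_foot hD hy,
      hcd _ _ _ _ (c.coe_base_of_notMem hD hx) (c.coe_base_of_notMem hD hy)]
    have hiff : c.proj x = c.proj y ↔ c.base hD x = c.base hD y := by
      constructor
      · intro h
        refine Subtype.ext ?_
        rw [c.coe_base_of_notMem hD hx, c.coe_base_of_notMem hD hy]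
        exact c.eq_of_proj_eq hD (by rw [(c.foot_spec hD x).2, (c.foot_spec hD y).2, h])
          (by rw [(c.foot_spec hD x).1, (c.foot_spec hD y).1])
      · intro h
        rw [← c.proj_base hD x, h, c.proj_base]
    simp only [hiff]
    split_ifs with h
    · rw [c.dist_of_proj_eq hD (hiff.2 h), c.whiskerLength_of_notMem hx,
        c.whiskerLength_of_notMem hy, sub_sub_sub_cancel_right]
    · rfl

theorem isMetric_d (hD : IsOpen D) (hb : Bornology.IsBounded D) : IsMetric c.d := by
  rw [c.d_eq_whiskerDist hD hb]
  exact isMetric_whiskerDist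
    (isMetric_intrinsicDist (c.isMetric_collarG hD) (c.lipJoined_collar hD hb))
    c.whiskerLength_nonneg (c.base_injective hD)

theorem isGeodesic_d (hD : IsOpen D) (hb : Bornology.IsBounded D) : IsGeodesic c.d := by
  refine isGeodesic_of_lipJoined (c.isMetric_d hD hb) fun x y => ?_
  have hg := c.isMetric_collarG hD
  rw [c.d_eq_whiskerDist hD hb]
  refine lipJoined_whiskerDist (isMetric_intrinsicDist hg (c.lipJoined_collar hD hb))
    c.whiskerLength_nonneg (c.base_injective hD)
    (fun p => ⟨p, c.base_of_mem hD p.2, c.whiskerLength_of_mem p.2⟩) (fun y s hs => ?_)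
    (fun p q => (lipJoined_intrinsicDist hg (c.continuous_collarG hD hb)
      (c.isCompact_collar_ball hD hb) (c.lipJoined_collar hD hb p q)).intrinsic) x y
  by_cases hy : y ∈ c.collar
  · rw [c.whiskerLength_of_mem hy, Set.Icc_self, Set.mem_singleton_iff] at hs
    exact ⟨y, rfl, hs ▸ c.whiskerLength_of_mem hy⟩
  · rw [c.whiskerLength_of_notMem hy] at hs
    have hε := c.ε_pos
    obtain ⟨z, hz1, hz2⟩ := c.exists_segment_point hD y (s := s + c.ε) (by linarith [hs.1])
      (by linarith [hs.2])
    refine ⟨z, Subtype.ext (c.eq_of_proj_eq hD ?_ ?_), ?_⟩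
    · rw [c.proj_base, c.proj_base, hz2]
    · rw [c.depth_base, c.depth_base, hz1, min_eq_right (by linarith [hs.1]),
        min_eq_right (by linarith [hs.1, hs.2])]
    · rw [whiskerLength, hz1, add_sub_cancel_right, max_eq_left hs.1]

/-- The metric agrees with the cone metric up to an additive constant. -/
theorem exists_abs_d_sub_le (hD : IsOpen D) (hb : Bornology.IsBounded D) :
    ∃ C, ∀ x y : D, |c.d x y - c.collarG (c.base hD x) (c.base hD y)| ≤ C := by
  obtain ⟨C, hC⟩ := c.exists_lipJoined hD hb
  have hI := isMetric_intrinsicDist (c.isMetric_collarG hD) (c.lipJoined_collar hD hb)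
  have hW : ∀ x, c.whiskerLength x ≤ Metric.diam (closure D) := fun x => by
    have h1 : c.depth x ≤ Metric.diam (closure D) := by
      refine (Metric.infDist_le_dist_of_mem (c.proj x).2).trans ?_
      exact Metric.dist_le_diam_of_mem hb.closure (subset_closure x.2)
        (frontier_subset_closure (c.proj x).2)
    exact max_le (by linarith [c.ε_pos]) Metric.diam_nonneg
  -- `C` is the excess of the length metric over `g`; each of the two whiskers is at most a diameter
  -- long.
  refine ⟨|C| + 2 * Metric.diam (closure D), fun x y => ?_⟩
  rw [c.d_eq_whiskerDist hD hb]
  have h1 := whiskerDist_le (b := c.base hD) hI c.whiskerLength_nonneg x y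
  have h2 := le_whiskerDist (b := c.base hD) hI c.whiskerLength_nonneg x y
  have h3 := le_intrinsicDist (c.lipJoined_collar hD hb (c.base hD x) (c.base hD y))
  obtain ⟨ℓ, hℓ0, hℓ, hℓC⟩ := hC (c.base hD x) (c.base hD y)
  have h4 := intrinsicDist_le hℓ0 hℓ
  have h5 := abs_nonneg (c.whiskerLength x - c.whiskerLength y)
  have h6 := le_abs_self C
  have h7 := abs_nonneg C
  have h8 : 0 ≤ Metric.diam (closure D) := Metric.diam_nonneg
  rw [abs_le]
  constructor <;> linarith [hW x, hW y]

theorem isGromovHyperbolic_d (hD : IsOpen D) (hb : Bornology.IsBounded D) :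
    IsGromovHyperbolic c.d := by
  obtain ⟨C, hC⟩ := c.exists_abs_d_sub_le hD hb
  refine isGromovHyperbolic_of_abs_sub_le (δ := Real.log 4) (fun x y z t => ?_)
    (Real.log_nonneg (by norm_num)) hC
  exact coneDist_four_point c.dH_isMetric (fun x => c.height_pos hD _) _ _ _ _

end ConstructionData

/-! ### The Gromov boundary of a hyperbolic cone -/

section Boundary

variable {Y Z : Type*} {dH : Z → Z → ℝ} {π : Y → Z} {η : Y → ℝ} {d : Y → Y → ℝ} {ω : Y} {C : ℝ}

/-- The Gromov product is `-log` of the gauge up to `C`, which turns divergence at infinity into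
convergence of the gauge to 0. -/
theorem tendsto_gromovProduct_iff (hZ : IsMetric dH) (hη : ∀ y, 0 < η y)
    (hC : ∀ x y, |gromovProduct d ω x y + Real.log (coneGauge dH π η x y)| ≤ C)
    {ι : Type*} {l : Filter ι} {u v : ι → Y} :
    Tendsto (fun i => gromovProduct d ω (u i) (v i)) l atTop ↔
      Tendsto (fun i => coneGauge dH π η (u i) (v i)) l (𝓝 0) := by
  have hpos := coneGauge_pos (π := π) hZ hη
  have hC' := fun x y => abs_le.1 (hC x y)
  constructor
  · intro h
    have h1 : Tendsto (fun i => Real.log (coneGauge dH π η (u i) (v i))) l atBot := by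
      refine tendsto_atBot_mono (fun i => ?_)
        (tendsto_atBot_add_const_right l C (tendsto_neg_atTop_atBot.comp h))
      have := (hC' (u i) (v i)).2
      simp only [Function.comp_apply]
      linarith
    refine (Real.tendsto_exp_atBot.comp h1).congr fun i => ?_
    exact Real.exp_log (hpos _ _)
  · intro h
    have h1 : Tendsto (fun i => Real.log (coneGauge dH π η (u i) (v i))) l atBot :=
      Real.tendsto_log_nhdsGT_zero.comp
        (tendsto_nhdsWithin_iff.2 ⟨h, Eventually.of_forall fun i => hpos _ _⟩)
    refine tendsto_atTop_mono (fun i => ?_)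
      (tendsto_atTop_add_const_right l (-C) (tendsto_neg_atBot_atTop.comp h1))
    have := (hC' (u i) (v i)).1
    simp only [Function.comp_apply]
    linarith

variable [TopologicalSpace Z]

theorem tendsto_coneGauge (hZ : IsMetric dH) (ht : InducesTopology dH) {ι : Type*} {l : Filter ι}
    {u v : ι → Y} {p q : Z} (hu : Tendsto (fun i => π (u i)) l (𝓝 p))
    (hv : Tendsto (fun i => π (v i)) l (𝓝 q)) (hu0 : Tendsto (fun i => η (u i)) l (𝓝 0))
    (hv0 : Tendsto (fun i => η (v i)) l (𝓝 0)) :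
    Tendsto (fun i => coneGauge dH π η (u i) (v i)) l (𝓝 (dH p q)) := by
  have := (((ht.continuous hZ).tendsto (p, q)).comp (hu.prodMk_nhds hv)).add (hu0.max hv0)
  rwa [max_self, add_zero] at this

/-- The gauge of a point with itself is its height, so the heights tend to 0 along the diagonal.
Since `dH` is below the gauge, the projections form a Cauchy sequence, and by compactness they
converge to an ultrafilter limit. -/
theorem SeqAtInfinity.exists_limit [CompactSpace Z] (hZ : IsMetric dH) (ht : InducesTopology dH)
    (hη : ∀ y, 0 < η y)
    (hC : ∀ x y, |gromovProduct d ω x y + Real.log (coneGauge dH π η x y)| ≤ C)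
    (x : SeqAtInfinity d ω) :
    ∃ p, Tendsto (fun i => π (x.1 i)) atTop (𝓝 p) ∧ Tendsto (fun i => η (x.1 i)) atTop (𝓝 0) := by
  have h := (tendsto_gromovProduct_iff hZ hη hC).1 x.2
  have hη0 : Tendsto (fun i => η (x.1 i)) atTop (𝓝 0) := by
    refine (h.comp tendsto_atTop_diagonal).congr fun i => ?_
    simp [coneGauge, hZ.self_eq_zero]
  obtain ⟨p, -, hp⟩ := isCompact_univ.ultrafilter_le_nhds
    ((hyperfilter ℕ).map fun i => π (x.1 i)) (by simp)
  have hp : Tendsto (fun i => π (x.1 i)) (hyperfilter ℕ) (𝓝 p) := hp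
  refine ⟨p, (ht.tendsto_iff hZ).2 (tendsto_order.2 ⟨fun a ha => Eventually.of_forall fun i =>
    ha.trans_le (hZ.nonneg _ _), fun r hr => ?_⟩), hη0⟩
  have h1 := h.eventually_lt_const (half_pos hr)
  obtain ⟨⟨n, m⟩, hnm⟩ := eventually_atTop.1 h1
  filter_upwards [eventually_ge_atTop n] with i hi
  have h2 : Tendsto (fun j => dH (π (x.1 i)) (π (x.1 j))) (hyperfilter ℕ)
      (𝓝 (dH (π (x.1 i)) p)) :=
    ((ht.continuous hZ).tendsto (π (x.1 i), p)).comp (tendsto_const_nhds.prodMk_nhds hp)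
  have h3 : dH (π (x.1 i)) p ≤ r / 2 := by
    refine le_of_tendsto h2 ?_
    filter_upwards [Nat.hyperfilter_le_atTop (eventually_ge_atTop m)] with j hj
    refine le_trans (le_add_of_nonneg_right ?_) (hnm (i, j) ⟨hi, hj⟩).le
    exact (hη _).le.trans (le_max_left _ _)
  rw [hZ.symm]
  linarith

/-- The Gromov boundary of a space whose Gromov product is, up to an additive constant, that of a
hyperbolic cone over a compact space `Z`, is homeomorphic to `Z`. -/
theorem exists_boundary_homeomorph [CompactSpace Z] (hZ : IsMetric dH) (ht : InducesTopology dH)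
    (hη : ∀ y, 0 < η y)
    (hC : ∀ x y, |gromovProduct d ω x y + Real.log (coneGauge dH π η x y)| ≤ C)
    (hsurj : ∀ p, ∃ y : ℕ → Y, (∀ i, π (y i) = p) ∧ Tendsto (fun i => η (y i)) atTop (𝓝 0)) :
    ∃ φ : GromovBoundary d ω ≃ₜ Z, ∀ x : SeqAtInfinity d ω,
      Tendsto (fun i => π (x.1 i)) atTop (𝓝 (φ (GromovBoundary.mk x))) ∧
        Tendsto (fun i => η (x.1 i)) atTop (𝓝 0) := by
  have hpos := coneGauge_pos (π := π) hZ hη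
  have hC' := fun x y => abs_le.1 (hC x y)
  choose lim hlim hlim0 using SeqAtInfinity.exists_limit (π := π) hZ ht hη hC
  have hgauge : ∀ x y : SeqAtInfinity d ω,
      Tendsto (fun i => coneGauge dH π η (x.1 i) (y.1 i)) atTop (𝓝 (dH (lim x) (lim y))) :=
    fun x y => tendsto_coneGauge hZ ht (hlim x) (hlim y) (hlim0 x) (hlim0 y)
  have hequiv : ∀ x y, SeqEquiv d ω x y ↔ lim x = lim y := fun x y => by
    rw [SeqEquiv, tendsto_gromovProduct_iff hZ hη hC]
    constructor
    · exact fun h => hZ.eq_of_eq_zero _ _ (tendsto_nhds_unique (hgauge x y) h)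
    · intro h
      have := hgauge x y
      rwa [h, hZ.self_eq_zero] at this
  let f : GromovBoundary d ω → Z := Quot.lift lim fun x y h => (hequiv x y).1 h
  have hf : Function.Bijective f := by
    refine ⟨?_, fun p => ?_⟩
    · rintro ⟨x⟩ ⟨y⟩ h
      exact Quot.sound ((hequiv x y).2 h)
    · obtain ⟨y, hy, hy0⟩ := hsurj p
      have hyp : Tendsto (fun i => π (y i)) atTop (𝓝 p) := by
        simp only [hy]
        exact tendsto_const_nhds
      have hseq : Tendsto (fun i : ℕ × ℕ => gromovProduct d ω (y i.1) (y i.2)) atTop atTop := by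
        rw [tendsto_gromovProduct_iff hZ hη hC, ← hZ.self_eq_zero p, ← prod_atTop_atTop_eq]
        exact tendsto_coneGauge hZ ht (hyp.comp tendsto_fst) (hyp.comp tendsto_snd)
          (hy0.comp tendsto_fst) (hy0.comp tendsto_snd)
      exact ⟨Quot.mk _ ⟨y, hseq⟩, hZ.eq_of_eq_zero _ _ (tendsto_nhds_unique tendsto_const_nhds
        (((ht.tendsto_iff hZ).1 (hlim ⟨y, hseq⟩)).congr fun i => by rw [hy i]))⟩
  have hball : ∀ a, ∀ r > 0, ∃ r' > 0, ∀ b ∈ gromovBall d ω a r', dH (f a) (f b) < r := by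
    intro a r hr
    -- If the limits are at distance at least `r`, the gauge eventually exceeds `r / 2` for any
    -- representatives, so every liminf in the supremum is at most `C - log (r / 2)`.
    refine ⟨Real.exp (-(C - Real.log (r / 2))), Real.exp_pos _, fun b hb => ?_⟩
    by_contra! hle
    refine absurd (show EReal.exp _ < _ from hb) (not_lt.2 ?_)
    rw [← EReal.exp_coe, EReal.exp_le_exp_iff, EReal.coe_neg, EReal.neg_le_neg_iff]
    refine iSup_le fun x => iSup_le fun y => iSup_le fun hx => iSup_le fun hy => ?_
    subst hx hy
    have h1 := (hgauge x y).eventually_const_lt (show r / 2 < _ by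
      change r ≤ dH (lim x) (lim y) at hle
      linarith)
    refine liminf_le_of_frequently_le' (h1.mono fun i hi => ?_).frequently
    have h2 := Real.log_le_log (half_pos hr) hi.le
    have h3 := (hC' (x.1 i) (y.1 i)).2
    exact EReal.coe_le_coe (by linarith)
  have hball' : ∀ a, ∀ r > 0, ∃ r' > 0, ∀ b, dH (f a) (f b) < r' → b ∈ gromovBall d ω a r := by
    rintro ⟨x⟩ r hr
    -- A gauge below this radius gives a product of at least `1 - log r`; the spare 1 makes the
    -- final inequality strict. One pair of representatives suffices, the boundary product being a
    -- supremum.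
    refine ⟨r * Real.exp (-(C + 1)), by positivity, ?_⟩
    rintro ⟨y⟩ hxy
    have h1 := (hgauge x y).eventually_lt_const hxy
    have h2 : ((1 - Real.log r : ℝ) : EReal) ≤
        liminf (fun i : ℕ => ((gromovProduct d ω (x.1 i) (y.1 i) : ℝ) : EReal)) atTop := by
      refine le_liminf_of_le (by isBoundedDefault) (h1.mono fun i hi => ?_)
      have h2 := Real.log_le_log (hpos _ _) hi.le
      rw [Real.log_mul hr.ne' (Real.exp_pos _).ne', Real.log_exp] at h2
      have h3 := (hC' (x.1 i) (y.1 i)).1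
      exact EReal.coe_le_coe (by linarith)
    have h3 : ((1 - Real.log r : ℝ) : EReal) ≤
        boundaryGromovProduct d ω (Quot.mk _ x) (Quot.mk _ y) :=
      le_iSup_of_le x (le_iSup_of_le y (le_iSup_of_le rfl (le_iSup_of_le rfl h2)))
    change EReal.exp _ < _
    refine lt_of_le_of_lt (EReal.exp_monotone (EReal.neg_le_neg_iff.2 h3)) ?_
    rw [← EReal.coe_neg, EReal.exp_coe, ENNReal.ofReal_lt_ofReal_iff hr,
      ← Real.lt_log_iff_exp_lt hr]
    linarith
  refine ⟨(Equiv.ofBijective f hf).toHomeomorph fun s => ?_, fun x => ⟨hlim x, hlim0 x⟩⟩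
  constructor
  · intro h
    refine (ht s).2 fun p hp => ?_
    obtain ⟨a, rfl⟩ := hf.2 p
    obtain ⟨r, hr, hrs⟩ := h a hp
    obtain ⟨r', hr', h'⟩ := hball' a r hr
    refine ⟨r', hr', fun q hq => ?_⟩
    obtain ⟨b, rfl⟩ := hf.2 q
    exact hrs (h' b hq)
  · intro h a ha
    obtain ⟨r, hr, hrs⟩ := (ht s).1 h _ ha
    obtain ⟨r', hr', h'⟩ := hball a r hr
    exact ⟨r', hr', fun b hb => hrs _ (h' b hb)⟩

end Boundary

/-! ### The Gromov boundary of the domain -/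

namespace ConstructionData

variable {N : ℕ} {D : Set (EuclideanSpace ℝ (Fin N))} (c : ConstructionData D)

/-- In the Gromov product the heights of `x` and `y` cancel. What remains besides `-log` of their
gauge involves only `η ω` and the gauges to `ω`, which lie between `η ω` and `Δ + √ε`. -/
theorem exists_gromovProduct_bound (hD : IsOpen D) (hb : Bornology.IsBounded D) (ω : D) :
    ∃ C, ∀ x y : D, |gromovProduct c.d ω x y +
      Real.log (coneGauge c.dH c.proj (fun x => c.height (c.base hD x)) x y)| ≤ C := by
  obtain ⟨C, hC⟩ := c.exists_abs_d_sub_le hD hb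
  obtain ⟨Δ, hΔ⟩ := c.exists_dH_le hb
  set η : D → ℝ := fun x => c.height (c.base hD x) with hη
  have hη0 : ∀ x, 0 < η x := fun x => c.height_pos hD _
  have hpos := coneGauge_pos (π := c.proj) c.dH_isMetric hη0
  have hG : ∀ x y : D, c.collarG (c.base hD x) (c.base hD y) =
      2 * Real.log (coneGauge c.dH c.proj η x y) - Real.log (η x) - Real.log (η y) := fun x y => by
    refine (coneDist_eq (π := fun x : c.collar => c.proj x) (h := fun x : c.collar => c.height x)
      c.dH_isMetric (fun x => c.height_pos hD x) _ _).trans ?_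
    simp only [coneGauge, c.proj_base, hη]
  have hω : ∀ x, |Real.log (coneGauge c.dH c.proj η x ω)| ≤
      |Real.log (η ω)| + |Real.log (Δ + √c.ε)| := fun x => by
    have h1 : η ω ≤ coneGauge c.dH c.proj η x ω :=
      le_add_of_nonneg_of_le (c.dH_isMetric.nonneg _ _) (le_max_right _ _)
    have h2 : coneGauge c.dH c.proj η x ω ≤ Δ + √c.ε :=
      add_le_add (hΔ _ _) (max_le (c.height_le _) (c.height_le _))
    have h3 := Real.log_le_log (hη0 ω) h1
    have h4 := Real.log_le_log (hpos x ω) h2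
    have h5 := neg_abs_le (Real.log (η ω))
    have h6 := le_abs_self (Real.log (Δ + √c.ε))
    have h7 := abs_nonneg (Real.log (η ω))
    have h8 := abs_nonneg (Real.log (Δ + √c.ε))
    rw [abs_le]
    constructor <;> linarith
  refine ⟨2 * C + 3 * |Real.log (η ω)| + 2 * |Real.log (Δ + √c.ε)|, fun x y => ?_⟩
  have e1 := abs_le.1 (hC x ω)
  have e2 := abs_le.1 (hC y ω)
  have e3 := abs_le.1 (hC x y)
  have e4 := abs_le.1 (hω x)
  have e5 := abs_le.1 (hω y)
  have h5 := neg_abs_le (Real.log (η ω))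
  have h6 := le_abs_self (Real.log (η ω))
  rw [hG] at e1 e2 e3
  rw [gromovProduct, abs_le]
  constructor <;> linarith

/-- Heights of base points see only `min depth ε`; once this is below `ε` it is the depth, i.e. the
Euclidean distance from `x i` to its projection, so both have the same limit. -/
theorem exists_boundary_homeomorph (hD : IsOpen D) (hb : Bornology.IsBounded D) (ω : D) :
    ∃ φ : GromovBoundary c.d ω ≃ₜ frontier D, ∀ x : SeqAtInfinity c.d ω,
      Tendsto (fun i => (x.1 i : EuclideanSpace ℝ (Fin N))) atTop
        (𝓝 (φ (GromovBoundary.mk x) : EuclideanSpace ℝ (Fin N))) := by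
  have : CompactSpace (frontier D) :=
    isCompact_iff_compactSpace.1 (isCompact_frontier_of_isBounded hb)
  obtain ⟨C, hC⟩ := c.exists_gromovProduct_bound hD hb ω
  obtain ⟨φ, hφ⟩ := _root_.exists_boundary_homeomorph c.dH_isMetric c.dH_topology
    (fun x => c.height_pos hD _) hC fun p => by
      have hε := Real.sqrt_pos.2 c.ε_pos
      have hk : ∀ i : ℕ, 0 < √c.ε / (i + 1) ∧ √c.ε / (i + 1) ≤ √c.ε := fun i =>
        ⟨by positivity, div_le_self hε.le (by linarith [Nat.cast_nonneg (α := ℝ) i])⟩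
      choose y hy using fun i : ℕ => c.collar_surjective hD p _ (hk i).1 (hk i).2
      refine ⟨fun i => y i, fun i => (hy i).1, ?_⟩
      have h1 : Tendsto (fun i : ℕ => √c.ε / ((i : ℝ) + 1)) atTop (𝓝 0) :=
        tendsto_const_nhds.div_atTop
          (tendsto_atTop_add_const_right _ _ tendsto_natCast_atTop_atTop)
      refine h1.congr fun i => ?_
      rw [c.base_of_mem hD (y i).2, (hy i).2]
  refine ⟨φ, fun x => ?_⟩
  obtain ⟨h1, h2⟩ := hφ x
  have h3 : Tendsto (fun i => min (c.depth (x.1 i)) c.ε) atTop (𝓝 0) := by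
    simpa [height_sq, depth_base] using h2.pow 2
  have h4 : Tendsto (fun i => c.depth (x.1 i)) atTop (𝓝 0) := by
    refine h3.congr' ?_
    filter_upwards [h3.eventually_lt_const c.ε_pos] with i hi
    exact min_eq_left (by rcases min_lt_iff.1 hi with h | h; exacts [h.le, absurd h (lt_irrefl _)])
  have h5 := (continuous_subtype_val.tendsto _).comp h1
  refine (tendsto_iff_of_dist ?_).1 h5
  refine h4.congr fun i => ?_
  rw [Function.comp_apply, dist_comm, c.dist_proj]
  rfl

end ConstructionData

/-! ### Existence of the data of the construction -/

section Existence

variable {N : ℕ} {D : Set (EuclideanSpace ℝ (Fin N))}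

section LocalDefiningFunction

variable {p : EuclideanSpace ℝ (Fin N)} {U : Set (EuclideanSpace ℝ (Fin N))}
  {ρ : EuclideanSpace ℝ (Fin N) → ℝ}

theorem IsLocalDefiningFunction.contDiffAt (h : IsLocalDefiningFunction D p U ρ)
    {q : EuclideanSpace ℝ (Fin N)} (hq : q ∈ U) : ContDiffAt ℝ 2 ρ q :=
  h.contDiffOn.contDiffAt (h.isOpen.mem_nhds hq)

theorem IsLocalDefiningFunction.differentiableAt (h : IsLocalDefiningFunction D p U ρ)
    {q : EuclideanSpace ℝ (Fin N)} (hq : q ∈ U) : DifferentiableAt ℝ ρ q :=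
  (h.contDiffAt hq).differentiableAt (by norm_num)

theorem IsLocalDefiningFunction.contDiffAt_fderiv (h : IsLocalDefiningFunction D p U ρ) :
    ContDiffAt ℝ 1 (fderiv ℝ ρ) p :=
  (h.contDiffAt h.mem).fderiv_right (by norm_num)

theorem inner_gradient_eq (f : EuclideanSpace ℝ (Fin N) → ℝ) (q v : EuclideanSpace ℝ (Fin N)) :
    inner ℝ (gradient f q) v = fderiv ℝ f q v := by
  rw [← toDual_gradient, InnerProductSpace.toDual_apply_apply]

theorem norm_gradient_eq (f : EuclideanSpace ℝ (Fin N) → ℝ) (q : EuclideanSpace ℝ (Fin N)) :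
    ‖gradient f q‖ = ‖fderiv ℝ f q‖ := by
  rw [← toDual_gradient, LinearIsometryEquiv.norm_map]

theorem IsLocalDefiningFunction.fderiv_ne_zero (h : IsLocalDefiningFunction D p U ρ) :
    fderiv ℝ ρ p ≠ 0 := by
  rw [← norm_pos_iff, ← norm_gradient_eq, norm_pos_iff]
  exact h.gradient_ne_zero

theorem IsLocalDefiningFunction.of_fderiv_ne_zero (h : IsLocalDefiningFunction D p U ρ)
    {q : EuclideanSpace ℝ (Fin N)} (hq : q ∈ U) (hq0 : fderiv ℝ ρ q ≠ 0) :
    IsLocalDefiningFunction D q U ρ where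
  isOpen := h.isOpen
  mem := hq
  contDiffOn := h.contDiffOn
  gradient_ne_zero := by
    rw [← norm_pos_iff, norm_gradient_eq, norm_pos_iff]
    exact hq0
  inter_eq := h.inter_eq

/-- Away from the closure of `D` the zero `p` would be a local minimum of `ρ`, contrary to the
nonzero derivative. -/
theorem IsLocalDefiningFunction.mem_frontier (h : IsLocalDefiningFunction D p U ρ) (hp : ρ p = 0) :
    p ∈ frontier D := by
  refine ⟨?_, fun hi => ?_⟩
  · by_contra hn
    have hmin : IsLocalMin ρ p := by
      filter_upwards [isClosed_closure.isOpen_compl.mem_nhds hn, h.isOpen.mem_nhds h.mem]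
        with y hy hyU
      rw [hp]
      by_contra! hneg
      have : y ∈ D ∩ U := by
        rw [h.inter_eq]
        exact ⟨hyU, hneg⟩
      exact hy (subset_closure this.1)
    exact h.fderiv_ne_zero hmin.fderiv_eq_zero
  · have : p ∈ D ∩ U := ⟨interior_subset hi, h.mem⟩
    rw [h.inter_eq] at this
    exact this.2.ne hp

/-- The boundary of a `C²` domain satisfies a locally uniform inner ball condition. -/
theorem IsLocalDefiningFunction.exists_inner_ball (hD : IsOpen D)
    (h : IsLocalDefiningFunction D p U ρ) :
    ∃ ε > 0, ∀ᶠ q in 𝓝 p, q ∈ frontier D → ∀ n, IsOuterNormal D q n → ∀ s, 0 < s → s ≤ ε →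
      Metric.closedBall (q - s • n) s ⊆ insert q D := by
  obtain ⟨K, T, hT, hK⟩ := h.contDiffAt_fderiv.exists_lipschitzOnWith
  obtain ⟨r, hr, hball⟩ := Metric.mem_nhds_iff.1 (inter_mem hT (h.isOpen.mem_nhds h.mem))
  set m := ‖fderiv ℝ ρ p‖ / 2 with hm
  have hpnorm : 0 < ‖fderiv ℝ ρ p‖ := norm_pos_iff.2 h.fderiv_ne_zero
  have hm0 : 0 < m := half_pos hpnorm
  have hev : ∀ᶠ q in 𝓝 p, m < ‖fderiv ℝ ρ q‖ :=
    h.contDiffAt_fderiv.continuousAt.norm.eventually_const_lt (half_lt_self hpnorm)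
  have hK1 : (0 : ℝ) < K + 1 := by positivity
  -- The first bound keeps the tangent balls at `q` inside `ball p r`. In such a ball `⟨u, n⟩ ≤
  -- -‖u‖²/(2s)`, so by the second bound the linear term of `ρ` is at most `-(K + 1)‖u‖²`, which
  -- beats the Taylor remainder `K‖u‖²`.
  refine ⟨min (r / 8) (m / (2 * (K + 1))), by positivity, ?_⟩
  filter_upwards [hev, Metric.ball_mem_nhds p (half_pos hr)] with q hqm hqr hq n hn s hs hsε y hy
  have hqB : q ∈ Metric.ball p r := Metric.ball_subset_ball (by linarith) hqr
  have hq' := h.of_fderiv_ne_zero (hball hqB).2 (norm_pos_iff.1 (hm0.trans hqm))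
  have hn' : n = ‖gradient ρ q‖⁻¹ • gradient ρ q := hn.unique hD hq ⟨U, ρ, hq', rfl⟩
  have hn1 := hn.norm_eq_one
  by_cases hyq : y = q
  · exact Or.inl hyq
  refine Or.inr ?_
  set u := y - q with hu
  have hu0 : 0 < ‖u‖ := norm_pos_iff.2 (sub_ne_zero.2 hyq)
  rw [Metric.mem_closedBall, dist_eq_norm, show y - (q - s • n) = u + s • n by rw [hu]; abel] at hy
  have hus : ‖u‖ ≤ 2 * s := by
    have := norm_sub_le (u + s • n) (s • n)
    rw [add_sub_cancel_right, norm_smul, hn1, Real.norm_of_nonneg hs.le] at this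
    linarith
  have hsq : ‖u‖ ^ 2 + 2 * s * inner ℝ u n ≤ 0 := by
    have := pow_le_pow_left₀ (norm_nonneg _) hy 2
    rw [norm_add_sq_real, norm_smul, hn1, real_inner_smul_right, Real.norm_of_nonneg hs.le] at this
    linarith
  have hyB : y ∈ Metric.ball p r := by
    have h1 := norm_add_le u (q - p)
    rw [hu, sub_add_sub_cancel] at h1
    rw [Metric.mem_ball, dist_eq_norm] at hqr ⊢
    have := hsε.trans (min_le_left _ _)
    linarith
  have hseg : segment ℝ q y ⊆ Metric.ball p r := (convex_ball p r).segment_subset hqB hyB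
  have hmv := Convex.norm_image_sub_le_of_norm_fderiv_le' (𝕜 := ℝ) (f := ρ) (φ := fderiv ℝ ρ q)
    (C := K * ‖u‖) (fun z hz => h.differentiableAt (hball (hseg hz)).2) (fun z hz => by
      have h1 := hK.norm_sub_le (hball (hseg hz)).1 (hball hqB).1
      have h2 : ‖z - q‖ ≤ ‖u‖ := by
        obtain ⟨t, ⟨ht0, ht1⟩, rfl⟩ := segment_eq_image' ℝ q y ▸ hz
        rw [add_sub_cancel_left, norm_smul, Real.norm_of_nonneg ht0]
        exact mul_le_of_le_one_left hu0.le ht1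
      exact h1.trans (mul_le_mul_of_nonneg_left h2 K.2)) (convex_segment q y)
    (left_mem_segment ℝ q y) (right_mem_segment ℝ q y)
  rw [hq'.eq_zero hD hq hq'.mem, sub_zero, ← hu, ← inner_gradient_eq] at hmv
  have hgn : gradient ρ q = ‖fderiv ℝ ρ q‖ • n := by
    rw [hn', norm_gradient_eq, smul_smul, mul_inv_cancel₀ (hm0.trans hqm).ne', one_smul]
  rw [hgn, real_inner_smul_left, real_inner_comm] at hmv
  have hmv2 := (le_abs_self _).trans hmv
  have hneg : inner ℝ u n ≤ -(‖u‖ ^ 2 / (2 * s)) := by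
    rw [le_neg, div_le_iff₀ (by positivity)]
    linarith
  have hgrad : ‖fderiv ℝ ρ q‖ * inner ℝ u n ≤ -((K + 1) * ‖u‖ ^ 2) := by
    have h1 : (K + 1) * (2 * s) ≤ m := by
      have := hsε.trans (min_le_right _ _)
      rw [le_div_iff₀ (by positivity)] at this
      linarith
    have h2 : (K + 1) * ‖u‖ ^ 2 ≤ m * (‖u‖ ^ 2 / (2 * s)) := by
      rw [← mul_div_assoc, le_div_iff₀ (by positivity)]
      have := mul_le_mul_of_nonneg_right h1 (sq_nonneg ‖u‖)
      linarith
    have h3 : m * (‖u‖ ^ 2 / (2 * s)) ≤ ‖fderiv ℝ ρ q‖ * -inner ℝ u n :=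
      mul_le_mul hqm.le (by linarith) (by positivity) (norm_nonneg _)
    linarith
  have : y ∈ D ∩ U := by
    rw [h.inter_eq]
    refine ⟨(hball hyB).2, ?_⟩
    have : 0 < ‖u‖ ^ 2 := by positivity
    change ρ y < 0
    linarith
  exact this.1

/-- Boundary points close to `p` are joined to `p` by short curves in the boundary. -/
theorem IsLocalDefiningFunction.eventually_lipJoined (hD : IsOpen D) {p : frontier D}
    (h : IsLocalDefiningFunction D p U ρ) {e : ℝ} (he : 0 < e) :
    ∀ᶠ q in 𝓝 p, LipJoined (fun x y : frontier D => dist x y) p q e := by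
  have hf : HasStrictFDerivAt ρ (fderiv ℝ ρ p) p :=
    (h.contDiffAt h.mem).hasStrictFDerivAt (by norm_num)
  have hf' : (fderiv ℝ ρ p).range = ⊤ :=
    LinearMap.range_eq_top.2 (LinearMap.surjective (fun h0 => h.fderiv_ne_zero
      (ContinuousLinearMap.coe_injective h0)))
  have hp0 : ρ p = 0 := h.eq_zero hD p.2 h.mem
  -- `ψ` is a Lipschitz chart of the level set of `ρ` through `p`, defined on the tangent space; the
  -- curves sought are the images of straight segments from 0.
  set ψ := hf.implicitFunction ρ _ hf' (ρ p) with hψ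
  obtain ⟨K, T, hT, hK⟩ := (hf.to_implicitFunction hf').exists_lipschitzOnWith
  have hψ0 : ψ 0 = p := hf.implicitFunction_apply_image hf'
  have hψc : ContinuousAt ψ 0 := (hf.to_implicitFunction hf').hasFDerivAt.continuousAt
  have hfr : ∀ᶠ z in 𝓝 (p : EuclideanSpace ℝ (Fin N)), ρ z = 0 → z ∈ frontier D := by
    filter_upwards [h.isOpen.mem_nhds h.mem,
      h.contDiffAt_fderiv.continuousAt.eventually_ne h.fderiv_ne_zero] with z hzU hz0 hz
    exact (h.of_fderiv_ne_zero hzU hz0).mem_frontier hz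
  have hzero : ∀ᶠ v in 𝓝 (0 : (fderiv ℝ ρ p).ker), ρ (ψ v) = ρ p :=
    ((continuous_const.prodMk continuous_id).tendsto'
      (0 : (fderiv ℝ ρ p).ker) (ρ p, 0) rfl).eventually (hf.map_implicitFunction_eq hf')
  have hmem : ∀ᶠ v in 𝓝 (0 : (fderiv ℝ ρ p).ker), ψ v ∈ frontier D ∧ v ∈ T := by
    filter_upwards [hzero, hψc.tendsto.eventually (hψ0.symm ▸ hfr), hT] with v hv hv' hvT
    exact ⟨hv' (hv.trans hp0), hvT⟩
  obtain ⟨δ, hδ, hδball⟩ := Metric.eventually_nhds_iff_ball.1 hmem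
  set Φ := hf.implicitToOpenPartialHomeomorph ρ _ hf' with hΦ
  have hΦc : ContinuousAt (fun z => (Φ z).2) (p : EuclideanSpace ℝ (Fin N)) :=
    (Φ.continuousAt (hf.mem_implicitToOpenPartialHomeomorph_source hf')).snd
  have hΦp : (Φ p).2 = 0 := by rw [hΦ, hf.implicitToOpenPartialHomeomorph_self hf']
  have hv : ∀ᶠ z in 𝓝 (p : EuclideanSpace ℝ (Fin N)), ‖(Φ z).2‖ < min δ (e / (K + 1)) := by
    refine hΦc.norm.eventually_lt_const ?_
    simp only [hΦp, norm_zero]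
    positivity
  filter_upwards [continuous_subtype_val.continuousAt.eventually (hf.eq_implicitFunction hf'),
    continuous_subtype_val.continuousAt.eventually hv,
    continuous_subtype_val.continuousAt.eventually (h.isOpen.mem_nhds h.mem)] with q hq hqv hqU
  rw [h.eq_zero hD q.2 hqU, ← hp0] at hq
  set v := (Φ q).2 with hvdef
  have hin : ∀ t ∈ Set.Icc (0 : ℝ) 1, t • v ∈ Metric.ball 0 δ := fun t ht => by
    rw [mem_ball_zero_iff, norm_smul, Real.norm_of_nonneg ht.1]
    exact (mul_le_of_le_one_left (norm_nonneg _) ht.2).trans_lt (hqv.trans_le (min_le_left _ _))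
  have : Nonempty (frontier D) := ⟨p⟩
  choose! P hP using fun t (ht : t ∈ Set.Icc (0 : ℝ) 1) =>
    (⟨⟨ψ (t • v), (hδball _ (hin t ht)).1⟩, rfl⟩ : ∃ z : frontier D, (z : _) = ψ (t • v))
  have hj := lipJoined_of_Icc (ρ := fun x y : frontier D => dist x y) (γ := P) zero_le_one he
    (fun s hs t ht => by
      rw [Subtype.dist_eq, hP s hs, hP t ht]
      refine (hK.dist_le_mul _ (hδball _ (hin s hs)).2 _ (hδball _ (hin t ht)).2).trans ?_
      rw [dist_eq_norm, ← sub_smul, norm_smul, Real.norm_eq_abs, mul_comm |s - t|, ← mul_assoc]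
      refine mul_le_mul_of_nonneg_right ?_ (abs_nonneg _)
      have h1 := hqv.le.trans (min_le_right _ _)
      rw [le_div_iff₀ (by positivity)] at h1
      linarith [norm_nonneg v])
  have e0 : P 0 = p := Subtype.ext (by rw [hP 0 (by simp), zero_smul, hψ0])
  have e1 : P 1 = q := Subtype.ext (by rw [hP 1 (by simp), one_smul]; exact hq)
  rwa [e0, e1, sub_zero, mul_one] at hj

end LocalDefiningFunction

theorem exists_inner_ball_radius (hD : IsOpen D) (hb : Bornology.IsBounded D)
    (hC2 : HasC2Boundary D) :
    ∃ ε > 0, ∀ q ∈ frontier D, ∀ n, IsOuterNormal D q n →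
      Metric.closedBall (q - ε • n) ε ⊆ insert q D := by
  -- Quantifying over all `s ≤ ε` makes the property stable under taking minima, as the compactness
  -- induction requires.
  have key : ∃ ε > 0, ∀ q ∈ frontier D, q ∈ frontier D → ∀ n, IsOuterNormal D q n → ∀ s, 0 < s →
      s ≤ ε → Metric.closedBall (q - s • n) s ⊆ insert q D := by
    refine (isCompact_frontier_of_isBounded hb).induction_on (p := fun S => ∃ ε > 0, ∀ q ∈ S,
      q ∈ frontier D → ∀ n, IsOuterNormal D q n → ∀ s, 0 < s → s ≤ ε →
        Metric.closedBall (q - s • n) s ⊆ insert q D) ⟨1, one_pos, by simp⟩ ?_ ?_ ?_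
    · rintro S T hST ⟨ε, hε, h⟩
      exact ⟨ε, hε, fun q hq => h q (hST hq)⟩
    · rintro S T ⟨ε, hε, h⟩ ⟨ε', hε', h'⟩
      refine ⟨min ε ε', lt_min hε hε', fun q hq hqD n hn s hs hsε => ?_⟩
      rcases hq with hq | hq
      · exact h q hq hqD n hn s hs (hsε.trans (min_le_left _ _))
      · exact h' q hq hqD n hn s hs (hsε.trans (min_le_right _ _))
    · intro p hp
      obtain ⟨U, ρ, hρ⟩ := hC2 p hp
      obtain ⟨ε, hε, h⟩ := hρ.exists_inner_ball hD
      exact ⟨_, mem_nhdsWithin_of_mem_nhds h, ε, hε, fun q hq => hq⟩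
  obtain ⟨ε, hε, h⟩ := key
  exact ⟨ε, hε, fun q hq n hn => h q hq hq n hn ε hε le_rfl⟩

/-- The boundary of a `C²` domain carries a geodesic metric that induces its topology. -/
theorem exists_geodesic_metric_frontier (hD : IsOpen D) (hb : Bornology.IsBounded D)
    (hC2 : HasC2Boundary D) (hconn : IsConnected (frontier D)) :
    ∃ dH : frontier D → frontier D → ℝ, IsMetric dH ∧ InducesTopology dH ∧ IsGeodesic dH := by
  have : CompactSpace (frontier D) :=
    isCompact_iff_compactSpace.1 (isCompact_frontier_of_isBounded hb)
  have : PreconnectedSpace (frontier D) := Subtype.preconnectedSpace hconn.isPreconnected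
  set ρ : frontier D → frontier D → ℝ := fun x y => dist x y with hρ
  have hm : IsMetric ρ := ⟨dist_self, fun _ _ => eq_of_dist_eq_zero, dist_comm, dist_triangle⟩
  have hloc : ∀ p : frontier D, ∀ e > 0, ∀ᶠ q in 𝓝 p, LipJoined ρ p q e := fun p e he => by
    obtain ⟨U, f, hf⟩ := hC2 p p.2
    exact hf.eventually_lipJoined hD he
  -- Joinability is an equivalence relation with open classes, so connectedness leaves a single
  -- class.
  have hJ : ∀ x y, ∃ ℓ, 0 ≤ ℓ ∧ LipJoined ρ x y ℓ :=
    PreconnectedSpace.induction₂' (fun x y => ∃ ℓ, 0 ≤ ℓ ∧ LipJoined ρ x y ℓ)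
      (fun x => (hloc x 1 one_pos).mono fun y hy =>
        ⟨⟨1, zero_le_one, hy⟩, ⟨1, zero_le_one, hy.symm⟩⟩)
      ⟨fun x y z ⟨a, ha, h⟩ ⟨b, hb, h'⟩ => ⟨a + b, add_nonneg ha hb, h.trans hm ha hb h'⟩⟩
  have hI := isMetric_intrinsicDist hm hJ
  -- The length metric dominates the Euclidean distance, and nearby points are joined by arbitrarily
  -- short curves, so the topologies agree; compactness supplies shortest curves.
  refine ⟨intrinsicDist ρ, hI, fun s => ⟨fun hs p hp => ?_, fun h => ?_⟩,
    isGeodesic_of_lipJoined hI fun x y => (lipJoined_intrinsicDist hm continuous_dist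
      (fun x R => (isClosed_le (by fun_prop) continuous_const).isCompact) (hJ x y)).intrinsic⟩
  · obtain ⟨r, hr, hrs⟩ := Metric.isOpen_iff.1 hs p hp
    refine ⟨r, hr, fun q hq => hrs ?_⟩
    rw [Metric.mem_ball, dist_comm]
    exact (le_intrinsicDist (hJ p q)).trans_lt hq
  · refine isOpen_iff_mem_nhds.2 fun p hp => ?_
    obtain ⟨r, hr, hrs⟩ := h p hp
    filter_upwards [hloc p (r / 2) (half_pos hr)] with q hq
    exact hrs q ((intrinsicDist_le (half_pos hr).le hq).trans_lt (half_lt_self hr))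

theorem nonempty_constructionData (hD : IsOpen D) (hb : Bornology.IsBounded D)
    (hC2 : HasC2Boundary D) (hconn : IsConnected (frontier D)) :
    Nonempty (ConstructionData D) := by
  obtain ⟨dH, h1, h2, h3⟩ := exists_geodesic_metric_frontier hD hb hC2 hconn
  obtain ⟨ε, hε, hball⟩ := exists_inner_ball_radius hD hb hC2
  have hproj : ∀ x : D, ∃ q : frontier D, dist (x : EuclideanSpace ℝ (Fin N)) q =
      Metric.infDist (x : EuclideanSpace ℝ (Fin N)) (frontier D) := fun x => by
    obtain ⟨q, hq, h⟩ := (isCompact_frontier_of_isBounded hb).exists_infDist_eq_dist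
      hconn.nonempty (x : EuclideanSpace ℝ (Fin N))
    exact ⟨⟨q, hq⟩, h.symm⟩
  choose proj hproj using hproj
  have hnormal : ∀ p : frontier D, ∃ n, IsOuterNormal D p n := fun p => by
    obtain ⟨U, ρ, hρ⟩ := hC2 p p.2
    exact ⟨_, U, ρ, hρ, rfl⟩
  choose normal hnormal using hnormal
  exact ⟨⟨dH, h1, h2, h3, proj, hproj, normal, hnormal, ε, hε, fun p => hball p p.2 _ (hnormal p)⟩⟩

end Existence

end

theorem theorem2 (N : ℕ) (D : Set (EuclideanSpace ℝ (Fin N)))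
    (hD_open : IsOpen D) (hD_conn : IsConnected D) (hD_bdd : Bornology.IsBounded D)
    (hD_C2 : HasC2Boundary D) (hbd_conn : IsConnected (frontier D)) :
    Nonempty (ConstructionData D) ∧
    ∀ c : ConstructionData D,
      IsMetric c.d ∧ IsGeodesic c.d ∧ IsGromovHyperbolic c.d ∧
      ∀ ω : D, ∃ φ : GromovBoundary c.d ω ≃ₜ frontier D,
        ∀ x : SeqAtInfinity c.d ω,
          Tendsto (fun i => (x.1 i : EuclideanSpace ℝ (Fin N))) atTop
            (𝓝 (φ (GromovBoundary.mk x) : EuclideanSpace ℝ (Fin N))) :=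
  ⟨nonempty_constructionData hD_open hD_bdd hD_C2 hbd_conn, fun c =>
    ⟨c.isMetric_d hD_open hD_bdd, c.isGeodesic_d hD_open hD_bdd,
      c.isGromovHyperbolic_d hD_open hD_bdd, c.exists_boundary_homeomorph hD_open hD_bdd⟩⟩
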